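/- **Setting.** An ordered Bratteli diagram $B=(V,E,\preceq)$ consists of finite levels of vertices $V_0=\{v_0\},V_1,V_2,\dots$ and finite sets $E_n$ ($n\ge 1$) of edges from $V_{n-1}$ to $V_n$, every vertex of $V_n$ being the end-point of some edge of $E_n$ ($n\ge1$) and the initial point of some edge of $E_{n+1}$ ($n\ge0$), with a partial order on each $E_n$ for which two edges are comparable if and only if they have the same end-point. For $m<n$, $E_{m,n}$ is the set of paths from $V_m$ to $V_n$; two paths of $E_{m,n}$ with the same end-point are compared through the last edge at which they differ. $X$ is the space of infinite paths $x=(x_1,x_2,\dots)$ starting at $v_0$, with the topology generated by cylinder sets. Assume that $B$ is properly ordered, i.e. that there are exactly one path $x_{\max}\in X$ all of whose edges are maximal and exactly one path $x_{\min}\in X$ all of whose edges are minimal. The Vershik map $T:X\to X$ sends $x_{\max}$ to $x_{\min}$ and, if $x\neq x_{\max}$ and $n$ is the least integer such that $x_n$ is not maximal, sends $x$ to $(y_1,\dots,y_n,x_{n+1},x_{n+2},\dots)$, where $y_n$ is the successor of $x_n$ and $y_1,\dots,y_{n-1}$ are minimal edges. For $x\in X$, $\tau_n(x)\in V_n$ is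 the vertex of level $n$ on the path $x$. Let $d$ be an integer and assume the following. * *(Proper of rank $d$.)* There is exactly one edge from $v_0$ to each vertex of $V_1$; for $n\ge2$ each vertex of $V_{n-1}$ is joined to each vertex of $V_n$ by at least one edge of $E_n$; for $n\ge 1$, $\#V_n=d$ and $V_n$ is identified with $\{1,\dots,d\}$; for $n\ge2$ all maximal edges of $E_n$ start in the same vertex. * *(Toeplitz type, characteristic sequence $(q_n)_{n\ge1}$.)* For every $n\ge1$, every vertex of $V_n$ is the end-point of exactly $q_n$ edges of $E_n$. Put $p_n=q_1\cdots q_n$ and $q_{m,n}=q_{m+1}\cdots q_n$ for $0\le m<n$. * *(Clean.)* There are $\delta>0$ and, for each ergodic $T$-invariant Borel probability measure $\mu$, a set $I_\mu\subseteq\{1,\dots,d\}$ such that $\mu(\tau_n=t)\ge\delta$ for all $t\in I_\mu$, $n\ge1$; $\lim_{n\to\infty}\mu(\tau_n=t)=0$ for all $t\notin I_\mu$; and $I_\mu\cap I_\nu=\emptyset$ whenever $\mu\ne\nu$ are ergodic. For $m<n$ and $x\in X$ let $\bar s_{m,n}(x)$ be the number of paths of $E_{m,n}$ ending at $\tau_n(x)$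 that are strictly bigger than $(x_{m+1},\dots,x_n)$, and for $t_1\in V_m$, $t_2\in V_n$ let $$\bar S_{m,n}(t_1,t_2)=\{\bar s_{m,n}(x)\;:\;x\in X,\ \tau_m(x)=t_1,\ \tau_n(x)=t_2\}.$$ A number $\lambda\in\mathbb C$ is a *non continuous eigenvalue* of $(X,T)$ for $\mu$ if there is a non-zero $f\in L^2(X,\mu)$ with $f\circ T=\lambda f$ $\mu$-almost everywhere, but there is no non-zero continuous $f:X\to\mathbb C$ with $f\circ T=\lambda f$. **Statement.** Let $\mu$ be an ergodic $T$-invariant Borel probability measure, let $a,b$ be integers with $b\ge1$ and $\gcd(a,b)=1$, and let $\lambda=\exp(2i\pi a/b)$. Then $\lambda$ is a non continuous eigenvalue of $(X,T)$ for $\mu$ if and only if 1. there is an integer $\mathbf b$ with $1<\mathbf b\le d$ such that $b/\gcd(b,p_n)=\mathbf b$ for all $n$ large enough, and 2. for all $t_2\in I_\mu$, $$\sum_{t_1\in I_\mu}\frac{\bigl|\sum_{s\in\bar S_{m,n}(t_1,t_2)}\lambda^{-p_m s}\bigr|}{q_{m,n}}\xrightarrow[m,n\to\infty]{}1$$ uniformly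 in $m<n$; that is, for every $\varepsilon>0$ there is $N$ such that for all $N\le m<n$ the left-hand side differs from $1$ by less than $\varepsilon$. -/

import Mathlib

open MeasureTheory Filter Topology

noncomputable section

/-! ### Eigenvalues of a dynamical system -/

/-- `lam` is a continuous eigenvalue of `(X, T)`. -/
def IsContinuousEigenvalue {X : Type*} [TopologicalSpace X] (T : X → X) (lam : ℂ) : Prop :=
  ∃ f : X → ℂ, Continuous f ∧ f ≠ 0 ∧ ∀ x, f (T x) = lam * f x

/-- `lam` is an eigenvalue of `(X, T)` with respect to `μ`: there is a non-zero
eigenfunction in `L²(μ)`. -/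
def IsMeasurableEigenvalue {X : Type*} [MeasurableSpace X] (T : X → X) (μ : Measure X)
    (lam : ℂ) : Prop :=
  ∃ f : X → ℂ, MemLp f 2 μ ∧ ¬ (f =ᵐ[μ] 0) ∧ ∀ᵐ x ∂μ, f (T x) = lam * f x

/-- `lam` is a non continuous eigenvalue of `(X, T)` for `μ`. -/
def IsNonContinuousEigenvalue {X : Type*} [TopologicalSpace X] [MeasurableSpace X] (T : X → X)
    (μ : Measure X) (lam : ℂ) : Prop :=
  IsMeasurableEigenvalue T μ lam ∧ ¬ IsContinuousEigenvalue T lam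

/-! ### Ordered Bratteli diagrams -/

/-- An ordered Bratteli diagram. The type `E n` is the set of edges joining vertices of level `n`
to vertices of level `n + 1` (it is usually written `E_{n+1}`). Two edges are comparable if and
only if they have the same end-point. -/
structure OrderedBratteliDiagram where
  V : ℕ → Type
  E : ℕ → Type
  finV : ∀ n, Finite (V n)
  finE : ∀ n, Finite (E n)
  root : Unique (V 0)
  src : ∀ {n : ℕ}, E n → V n
  tgt : ∀ {n : ℕ}, E n → V (n + 1)
  src_surj : ∀ (n : ℕ) (v : V n), ∃ e : E n, src e = v
  tgt_surj : ∀ (n : ℕ) (v : V (n + 1)), ∃ e : E n, tgt e = v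
  ord : ∀ n, PartialOrder (E n)
  comparable_iff : ∀ (n : ℕ) (e f : E n), (e ≤ f ∨ f ≤ e) ↔ tgt e = tgt f

namespace OrderedBratteliDiagram

attribute [instance] OrderedBratteliDiagram.finV OrderedBratteliDiagram.finE
  OrderedBratteliDiagram.ord OrderedBratteliDiagram.root

variable (B : OrderedBratteliDiagram)

/-- The entries of the incidence matrices: the number of edges from `u` to `v`. -/
def incidence (n : ℕ) (u : B.V n) (v : B.V (n + 1)) : ℕ :=
  Nat.card {e : B.E n // B.src e = u ∧ B.tgt e = v}

/-- The space `X_B` of infinite paths starting at the root. -/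
def Path : Type :=
  {x : ∀ n, B.E n // ∀ n, B.tgt (x n) = B.src (x (n + 1))}

/-- The topology generated by cylinder sets: the topology induced by the product of the discrete
topologies on the sets of edges. -/
instance : TopologicalSpace B.Path :=
  TopologicalSpace.induced Subtype.val
    (@Pi.topologicalSpace ℕ B.E (fun _ => ⊥))

/-- The Borel `σ`-algebra of `X_B`. -/
instance : MeasurableSpace B.Path := borel B.Path

instance : BorelSpace B.Path := ⟨rfl⟩

/-- The vertex of level `n` visited by the path `x`, i.e. the tower of level `n` containing `x`. -/
def tau (n : ℕ) (x : B.Path) : B.V n := B.src (x.1 n)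

/-- There are exactly one infinite path with only maximal edges and exactly one infinite path with
only minimal edges. -/
def IsProperlyOrdered : Prop :=
  (∃! x : B.Path, ∀ n, IsMax (x.1 n)) ∧ (∃! y : B.Path, ∀ n, IsMin (y.1 n))

/-- The graph of the Vershik map. If `x` is not the maximal path and `n` is the first index for
which `x n` is not maximal, then `y n` is the successor of `x n`, the edges of `y` before `n` are
minimal, and `y` coincides with `x` after `n`. The maximal path is sent to the minimal path. -/
def VershikRel (x y : B.Path) : Prop :=
  (∃ n, (∀ i < n, IsMax (x.1 i)) ∧ x.1 n ⋖ y.1 n ∧ (∀ i < n, IsMin (y.1 i)) ∧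
      ∀ i > n, y.1 i = x.1 i) ∨
    ((∀ n, IsMax (x.1 n)) ∧ ∀ n, IsMin (y.1 n))

variable {B}

theorem tgt_eq_of_le {n : ℕ} {e f : B.E n} (h : e ≤ f) : B.tgt e = B.tgt f :=
  (B.comparable_iff n e f).1 (Or.inl h)

theorem isMin_unique {n : ℕ} {e f : B.E n} (he : IsMin e) (hf : IsMin f)
    (h : B.tgt e = B.tgt f) : e = f := by
  rcases (B.comparable_iff n e f).2 h with h | h
  · exact le_antisymm h (hf h)
  · exact le_antisymm (he h) h

theorem exists_isMin_tgt {n : ℕ} (v : B.V (n + 1)) : ∃ e : B.E n, IsMin e ∧ B.tgt e = v := by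
  obtain ⟨e, rfl⟩ := B.tgt_surj n v
  obtain ⟨f, hfe, hf⟩ := Set.Finite.exists_le_minimal (Set.toFinite (Set.univ : Set (B.E n)))
    (Set.mem_univ e)
  exact ⟨f, fun g hg => hf.2 (Set.mem_univ g) hg, tgt_eq_of_le hfe⟩

theorem exists_minimal_path (n : ℕ) (e : B.E n) :
    ∃ p : ∀ i, B.E i, p n = e ∧
      ∀ i < n, IsMin (p i) ∧ B.tgt (p i) = B.src (p (i + 1)) := by
  induction n with
  | zero =>
    have : ∀ i, Nonempty (B.E i) := by
      intro i
      induction i with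
      | zero => exact ⟨e⟩
      | succ i ih =>
        obtain ⟨f⟩ := ih
        exact ⟨(B.src_surj (i + 1) (B.tgt f)).choose⟩
    refine ⟨Function.update (fun i => (this i).some) 0 e, by simp, fun i hi => by omega⟩
  | succ n ih =>
    obtain ⟨f, hf, hfe⟩ := exists_isMin_tgt (B.src e)
    obtain ⟨p, hp, hpm⟩ := ih f
    refine ⟨Function.update p (n + 1) e, by simp, fun i hi => ?_⟩
    rcases Nat.lt_succ_iff_lt_or_eq.1 hi with h | rfl
    · rw [Function.update_of_ne (by omega), Function.update_of_ne (by omega)]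
      exact hpm i h
    · rw [Function.update_of_ne (by omega), Function.update_self, hp]
      exact ⟨hf, hfe⟩

/-- The Vershik map is well defined on a properly ordered diagram. -/
theorem existsUnique_vershikRel (hB : B.IsProperlyOrdered) (x : B.Path) :
    ∃! y, B.VershikRel x y := by
  classical
  by_cases hx : ∀ n, IsMax (x.1 n)
  · obtain ⟨y, hy, huniq⟩ := hB.2
    refine ⟨y, Or.inr ⟨hx, hy⟩, ?_⟩
    rintro z (⟨n, -, hcov, -⟩ | ⟨-, hz⟩)
    · exact absurd (hx n) (not_isMax_of_lt hcov.lt)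
    · exact huniq z hz
  · push Not at hx
    have hmin : ∀ i < Nat.find hx, IsMax (x.1 i) := fun i hi =>
      not_not.1 (Nat.find_min hx hi)
    have hnot := Nat.find_spec hx
    generalize Nat.find hx = n at hmin hnot
    obtain ⟨g, hg⟩ := not_isMax_iff.1 hnot
    have hcov : ∃ f, x.1 n ⋖ f := by
      obtain ⟨f, hfg, hf⟩ := Set.Finite.exists_le_minimal (Set.toFinite (Set.Ioi (x.1 n))) hg
      exact ⟨f, hf.1, fun c hc hcf => (hf.2 hc hcf.le).not_gt hcf⟩
    obtain ⟨f, hf⟩ := hcov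
    obtain ⟨p, hpf, hp⟩ := exists_minimal_path n f
    have hchain : ∀ i, B.tgt (if i ≤ n then p i else x.1 i) =
        B.src (if i + 1 ≤ n then p (i + 1) else x.1 (i + 1)) := by
      intro i
      rcases lt_trichotomy i n with h | rfl | h
      · rw [if_pos h.le, if_pos (by omega)]
        exact (hp i h).2
      · rw [if_pos le_rfl, if_neg (by omega), hpf, ← x.2, tgt_eq_of_le hf.le]
      · rw [if_neg (by omega), if_neg (by omega), x.2]
    refine ⟨⟨fun i => if i ≤ n then p i else x.1 i, hchain⟩, Or.inl ⟨n, hmin, ?_, ?_, ?_⟩, ?_⟩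
    · simpa [hpf] using hf
    · intro i hi
      simpa [hi.le] using (hp i hi).1
    · intro i hi
      simp [not_le.2 hi]
    · rintro z (⟨k, hk, hcov, hzmin, hz⟩ | ⟨hmax, -⟩)
      · have hkn : k = n := by
          rcases lt_trichotomy k n with h | h | h
          · exact absurd (hmin k h) (not_isMax_of_lt hcov.lt)
          · exact h
          · exact absurd (hk n h) hnot
        subst hkn
        have htop : z.1 k = f := by
          rcases (B.comparable_iff k (z.1 k) f).2
            ((tgt_eq_of_le hcov.le).symm.trans (tgt_eq_of_le hf.le)) with h | h
          · exact h.eq_of_not_lt fun h' => hf.2 hcov.lt h'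
          · exact (h.eq_of_not_lt fun h' => hcov.2 hf.lt h').symm
        have hlow : ∀ j i, i + j = k → z.1 i = p i := by
          intro j
          induction j with
          | zero => rintro i rfl; exact htop.trans hpf.symm
          | succ j ih =>
            intro i hi
            have h1 : z.1 (i + 1) = p (i + 1) := ih (i + 1) (by omega)
            refine isMin_unique (hzmin i (by omega)) (hp i (by omega)).1 ?_
            rw [z.2, h1, (hp i (by omega)).2]
        apply Subtype.ext
        funext i
        by_cases hi : i ≤ k
        · simpa [hi] using hlow (k - i) i (by omega)
        · simpa [hi] using hz i (by omega)
      · exact absurd (hmax n) hnot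

variable (B)

/-- The Vershik map of a properly ordered Bratteli diagram. -/
def vershik (hB : B.IsProperlyOrdered) (x : B.Path) : B.Path :=
  (existsUnique_vershikRel hB x).choose

theorem vershik_spec (hB : B.IsProperlyOrdered) (x : B.Path) :
    B.VershikRel x (B.vershik hB x) :=
  (existsUnique_vershikRel hB x).choose_spec.1

/-- Properties (H1) to (H4) of a proper representation of rank `d`. The maps `label n`, for
`n ≥ 1`, are the identifications of `{1, …, d}` with the set of vertices of level `n`. -/
structure IsProper {d : ℕ} (label : ∀ n, Fin d → B.V n) : Prop where
  hat : ∀ (u : B.V 0) (v : B.V 1), B.incidence 0 u v = 1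
  pos : ∀ n ≥ 1, ∀ (u : B.V n) (v : B.V (n + 1)), 0 < B.incidence n u v
  rank : ∀ n ≥ 1, Function.Bijective (label n)
  max_src : ∀ n ≥ 1, ∀ e f : B.E n, IsMax e → IsMax f → B.src e = B.src f

/-- The diagram is of Toeplitz type with characteristic sequence `(q n; n ≥ 1)`: every vertex of
level `n ≥ 1` is the end-point of exactly `q n` edges. -/
def IsToeplitz (q : ℕ → ℕ) : Prop :=
  ∀ (n : ℕ) (v : B.V (n + 1)), Nat.card {e : B.E n // B.tgt e = v} = q (n + 1)

/-- The diagram is clean, where `Iset μ` is the set of vertices `I_μ`, for `μ` ergodic. -/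
def IsClean {d : ℕ} (hB : B.IsProperlyOrdered) (label : ∀ n, Fin d → B.V n)
    (Iset : Measure B.Path → Finset (Fin d)) : Prop :=
  ∃ δ : ℝ, 0 < δ ∧
    (∀ μ : Measure B.Path, IsProbabilityMeasure μ → Ergodic (B.vershik hB) μ →
      (∀ t ∈ Iset μ, ∀ n ≥ 1, δ ≤ μ.real {x | B.tau n x = label n t}) ∧
      (∀ t ∉ Iset μ, Tendsto (fun n => μ.real {x | B.tau n x = label n t}) atTop (𝓝 0))) ∧
    (∀ μ ν : Measure B.Path, IsProbabilityMeasure μ → Ergodic (B.vershik hB) μ →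
      IsProbabilityMeasure ν → Ergodic (B.vershik hB) ν → μ ≠ ν → Disjoint (Iset μ) (Iset ν))

/-- The set `E_{m,n}` of finite paths from level `m` to level `n`. -/
def FinPath (m n : ℕ) : Type :=
  {p : ∀ i : Set.Ico m n, B.E i //
    ∀ (i : ℕ) (hi : i ∈ Set.Ico m n) (hi' : i + 1 ∈ Set.Ico m n),
      B.tgt (p ⟨i, hi⟩) = B.src (p ⟨i + 1, hi'⟩)}

instance (m n : ℕ) : Finite (B.FinPath m n) := Subtype.finite

variable {B}

/-- The segment of the infinite path `x` between levels `m` and `n`. -/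
def Path.segment (x : B.Path) (m n : ℕ) : B.FinPath m n :=
  ⟨fun i => x.1 i, fun i _ _ => x.2 i⟩

/-- Two paths of `E_{m,n}` have the same end-point in level `n`. -/
def FinPath.SameEnd {m n : ℕ} (e f : B.FinPath m n) : Prop :=
  ∀ i : Set.Ico m n, (i : ℕ) + 1 = n → B.tgt (e.1 i) = B.tgt (f.1 i)

/-- The strict order induced on `E_{m,n}`: at the last index where `e` and `f` differ, the edge of
`e` is smaller than the edge of `f`. -/
def FinPath.Lt {m n : ℕ} (e f : B.FinPath m n) : Prop :=
  ∃ i : Set.Ico m n, (∀ j : Set.Ico m n, i < j → e.1 j = f.1 j) ∧ e.1 i < f.1 i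

variable (B)

/-- The number of paths of `E_{m,n}` ending at the vertex of level `n` of `x` which are strictly
bigger than the segment of `x` between levels `m` and `n`. -/
def suffix (m n : ℕ) (x : B.Path) : ℕ :=
  Nat.card {p : B.FinPath m n // p.SameEnd (x.segment m n) ∧ (x.segment m n).Lt p}

/-- The set of values of the function `suffix m n` on the paths that visit `t₁` at level `m` and
`t₂` at level `n`. -/
def suffixSet (m n : ℕ) (t₁ : B.V m) (t₂ : B.V n) : Set ℕ :=
  {s | ∃ x : B.Path, B.tau m x = t₁ ∧ B.tau n x = t₂ ∧ B.suffix m n x = s}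

theorem suffixSet_finite (m n : ℕ) (t₁ : B.V m) (t₂ : B.V n) :
    (B.suffixSet m n t₁ t₂).Finite := by
  refine (Set.finite_Iic (Nat.card (B.FinPath m n))).subset ?_
  rintro s ⟨x, -, -, rfl⟩
  exact Finite.card_subtype_le _

/-- The finite set `suffixSet` as a `Finset`. -/
def suffixFinset (m n : ℕ) (t₁ : B.V m) (t₂ : B.V n) : Finset ℕ :=
  (B.suffixSet_finite m n t₁ t₂).toFinset

end OrderedBratteliDiagram

/-- `q_{m,n} = q_{m+1} ⋯ q_n`. -/
def qProd (q : ℕ → ℕ) (m n : ℕ) : ℕ := ∏ i ∈ Finset.Ioc m n, q i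

/-- `p_n = q_1 ⋯ q_n`. -/
def pProd (q : ℕ → ℕ) (n : ℕ) : ℕ := qProd q 0 n

end

/-! Write `p_n = qProd q 0 n`. The height `addr q 0 n x` of `x` in its tower of level `n`, counted
from the top, is a mixed-radix number whose digits are the edge ranks. The Vershik map lowers it by
one modulo `p_n` (`addr_of_vershikRel`), and `addr_{0,n} = addr_{0,m} + p_m * addr_{m,n}`, where
`addr_{m,n}` is the suffix count (`suffix_eq_addr`). An invariant measure spreads its mass equally
over the levels of a tower, so the exponential sums of the statement are, up to a factor, integrals
over `{tau m = t₁} ∩ {tau n = t₂}` (`setIntegral_tau_tau_comp_addr`).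

Continuity: tops of towers of growing level converge to the maximal path, since maximal edges of one
level share their source. A continuous eigenfunction therefore forces `lam ^ p_n → 1`, and for a
root of unity this means `lam ^ p_n = 1` for some `n` (`isContinuousEigenvalue_iff`). As `lam ^ p_n`
has order `b / gcd(b, p_n)`, the eigenvalue fails to be continuous exactly when this order never
reaches 1.

Necessity: for an eigenfunction `f`, the function `lam ^ addr_{0,n} * f` does not change along a
tower. Since `f` is close to a function of finitely many edges, this product is close in L¹ to a
unimodular function of `tau n` (`exists_integral_sub_comp_tau_le`). Comparing levels `m` and `n`,
the phase `lam ^ (-p_m * addr_{m,n})` nearly depends on the two vertices only, so there is almost no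
cancellation in the sums (`abs_sum_suffix_sub_one_lt`). When `f` takes values in roots of unity, the
law of `lam ^ addr_{0,m} * f` is invariant under rotation by `lam ^ p_m` but nearly carried by `d`
values, which bounds the order by `d` (`exists_orderOf_le_card`).

Sufficiency: `lam ^ (-addr_{0,n})` restricted to the tower of `t₂` satisfies the eigenvalue equation
off a set of measure `1 / p_n`. A weak cluster point in L² is an eigenvector, and the second
condition keeps its pairings with functions of one fixed level away from zero
(`isMeasurableEigenvalue_of_le_sum_suffix`). -/

/-! ### Products of the characteristic sequence. -/

theorem qProd_self (q : ℕ → ℕ) (m : ℕ) : qProd q m m = 1 := by simp [qProd]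

theorem qProd_succ (q : ℕ → ℕ) {m n : ℕ} (h : m ≤ n) :
    qProd q m (n + 1) = qProd q m n * q (n + 1) := by
  simp [qProd, Finset.prod_Ioc_succ_top h]

theorem qProd_mul_qProd (q : ℕ → ℕ) {l m n : ℕ} (h : l ≤ m) (h' : m ≤ n) :
    qProd q l m * qProd q m n = qProd q l n :=
  Finset.prod_Ioc_consecutive q h h'

theorem eq_and_eq_of_add_mul_eq {c a a' r r' : ℕ} (ha : a < c) (ha' : a' < c)
    (h : a + c * r = a' + c * r') : a = a' ∧ r = r' := by
  have hc : 0 < c := by omega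
  have h1 := congrArg (· % c) h
  have h2 := congrArg (· / c) h
  simp only [Nat.add_mul_mod_self_left, Nat.mod_eq_of_lt ha, Nat.mod_eq_of_lt ha',
    Nat.add_mul_div_left _ _ hc, Nat.div_eq_of_lt ha, Nat.div_eq_of_lt ha', zero_add] at h1 h2
  exact ⟨h1, h2⟩

namespace OrderedBratteliDiagram

variable {B : OrderedBratteliDiagram}

theorem tau_succ (n : ℕ) (x : B.Path) : B.tau (n + 1) x = B.tgt (x.1 n) := (x.2 n).symm

theorem tau_eq_of_forall_ge {n : ℕ} {x y : B.Path} (h : ∀ i ≥ n, y.1 i = x.1 i) :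
    B.tau n y = B.tau n x := by
  simp [tau, h n le_rfl]

/-! ### Extension of finite paths -/

theorem exists_path_extending (n : ℕ) (f : ∀ i, B.E i)
    (hf : ∀ i < n, B.tgt (f i) = B.src (f (i + 1))) :
    ∃ y : B.Path, ∀ i ≤ n, y.1 i = f i := by
  let g : ∀ i, B.E i := fun i => Nat.rec (motive := fun i => B.E i) (f 0)
    (fun i e => if i + 1 ≤ n then f (i + 1) else (B.src_surj (i + 1) (B.tgt e)).choose) i
  have hg : ∀ i ≤ n, g i = f i := by
    intro i hi
    cases i with
    | zero => rfl
    | succ i => exact if_pos hi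
  refine ⟨⟨g, fun i => ?_⟩, hg⟩
  by_cases hi : i + 1 ≤ n
  · rw [hg i (by omega), hg (i + 1) hi, hf i (by omega)]
  · have : g (i + 1) = (B.src_surj (i + 1) (B.tgt (g i))).choose := if_neg hi
    rw [this, (B.src_surj (i + 1) (B.tgt (g i))).choose_spec]

theorem exists_tau_eq (n : ℕ) (v : B.V n) : ∃ y : B.Path, B.tau n y = v := by
  obtain ⟨e, rfl⟩ := B.src_surj n v
  obtain ⟨p, hp, hpm⟩ := exists_minimal_path n e
  obtain ⟨y, hy⟩ := exists_path_extending n p fun i hi => (hpm i hi).2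
  exact ⟨y, by rw [tau, hy n le_rfl, hp]⟩

theorem exists_path_through (x : B.Path) (n : ℕ) (e : B.E n) (h : B.tgt e = B.tau (n + 1) x) :
    ∃ y : B.Path, y.1 n = e ∧ ∀ i > n, y.1 i = x.1 i := by
  obtain ⟨p, hp, hpm⟩ := exists_minimal_path n e
  refine ⟨⟨fun i => if i ≤ n then p i else x.1 i, fun i => ?_⟩, by simp [hp], fun i hi => ?_⟩
  · change B.tgt (if i ≤ n then p i else x.1 i) = B.src (if i + 1 ≤ n then p (i + 1) else x.1 (i + 1))
    rcases lt_trichotomy i n with hi | rfl | hi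
    · rw [if_pos hi.le, if_pos (by omega), (hpm i hi).2]
    · rw [if_pos le_rfl, if_neg (by omega), hp, h, tau]
    · rw [if_neg (by omega), if_neg (by omega), x.2]
  · simp [not_le.2 hi]

theorem exists_segment_eq {m n : ℕ} (hmn : m < n) (p : B.FinPath m n) :
    ∃ y : B.Path, y.segment m n = p := by
  obtain ⟨p₀, hp₀, hpm⟩ := exists_minimal_path m (p.1 ⟨m, le_rfl, hmn⟩)
  let f : ∀ i, B.E i := fun i => if h : m ≤ i ∧ i < n then p.1 ⟨i, h⟩ else p₀ i
  have hf : ∀ i (h : m ≤ i ∧ i < n), f i = p.1 ⟨i, h⟩ := fun i h => dif_pos h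
  have hf' : ∀ i ≤ m, f i = p₀ i := by
    intro i hi
    rcases hi.eq_or_lt with rfl | hi
    · rw [hf i ⟨le_rfl, hmn⟩, hp₀]
    · exact dif_neg (by omega)
  obtain ⟨y, hy⟩ := exists_path_extending (n - 1) f (by
    intro i hi
    by_cases him : i < m
    · rw [hf' i him.le, hf' (i + 1) him, (hpm i him).2]
    · rw [hf i (by omega), hf (i + 1) (by omega)]
      exact p.2 i _ _)
  refine ⟨y, Subtype.ext (funext fun i => ?_)⟩
  have := i.2.2
  exact (hy i (by omega)).trans (hf i i.2)

/-! ### Rank of an edge -/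

/-- The number of edges which are strictly bigger than `e`. -/
noncomputable def edgeRank {n : ℕ} (e : B.E n) : ℕ := (Set.Ioi e).ncard

theorem edgeRank_lt_edgeRank {n : ℕ} {e f : B.E n} (h : e < f) : edgeRank f < edgeRank e :=
  Set.ncard_lt_ncard (Set.Ioi_ssubset_Ioi h) (Set.toFinite _)

theorem lt_or_eq_or_gt_of_tgt_eq {n : ℕ} {e f : B.E n} (h : B.tgt e = B.tgt f) :
    e < f ∨ e = f ∨ f < e := by
  rcases (B.comparable_iff n e f).2 h with h | h
  · exact h.lt_or_eq.imp_right Or.inl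
  · exact Or.inr (h.lt_or_eq.symm.imp_left Eq.symm)

theorem lt_iff_edgeRank_lt {n : ℕ} {e f : B.E n} (h : B.tgt e = B.tgt f) :
    e < f ↔ edgeRank f < edgeRank e := by
  refine ⟨edgeRank_lt_edgeRank, fun h' => ?_⟩
  rcases lt_or_eq_or_gt_of_tgt_eq h with h | rfl | h
  · exact h
  · exact absurd h' (lt_irrefl _)
  · exact absurd (edgeRank_lt_edgeRank h) h'.not_gt

theorem eq_of_edgeRank_eq {n : ℕ} {e f : B.E n} (h : B.tgt e = B.tgt f)
    (h' : edgeRank e = edgeRank f) : e = f := by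
  rcases lt_or_eq_or_gt_of_tgt_eq h with h | h | h
  · exact absurd (edgeRank_lt_edgeRank h) h'.not_gt
  · exact h
  · exact absurd (edgeRank_lt_edgeRank h) h'.not_lt

theorem edgeRank_eq_zero_of_isMax {n : ℕ} {e : B.E n} (h : IsMax e) : edgeRank e = 0 := by
  rw [edgeRank, Set.Ioi_eq_empty_iff.2 h, Set.ncard_empty]

theorem isMax_of_edgeRank_eq_zero {n : ℕ} {e : B.E n} (h : edgeRank e = 0) : IsMax e :=
  Set.Ioi_eq_empty_iff.1 ((Set.ncard_eq_zero (Set.toFinite _)).1 h)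

section Toeplitz

variable {q : ℕ → ℕ} (hq : B.IsToeplitz q)
include hq

theorem IsToeplitz.edgeRank_lt {n : ℕ} (e : B.E n) : edgeRank e < q (n + 1) := by
  rw [← hq n (B.tgt e), ← Set.coe_ofPred, Nat.card_coe_set_eq]
  refine Set.ncard_lt_ncard ⟨fun f hf => (tgt_eq_of_le (le_of_lt hf)).symm, fun h => ?_⟩
    (Set.toFinite _)
  exact lt_irrefl e (h (show B.tgt e = B.tgt e from rfl))

theorem IsToeplitz.exists_edgeRank_eq {n : ℕ} (v : B.V (n + 1)) {k : ℕ} (hk : k < q (n + 1)) :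
    ∃ e : B.E n, B.tgt e = v ∧ edgeRank e = k := by
  let g : {e : B.E n // B.tgt e = v} → Fin (q (n + 1)) :=
    fun e => ⟨edgeRank e.1, hq.edgeRank_lt e.1⟩
  have hg : Function.Bijective g := by
    refine Function.Injective.bijective_of_nat_card_le (fun e f h => Subtype.ext ?_) ?_
    · exact eq_of_edgeRank_eq (e.2.trans f.2.symm) (congrArg Fin.val h)
    · rw [hq n v, Nat.card_eq_fintype_card, Fintype.card_fin]
  obtain ⟨e, he⟩ := hg.2 ⟨k, hk⟩
  exact ⟨e.1, e.2, congrArg Fin.val he⟩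

theorem IsToeplitz.edgeRank_add_one_of_isMin {n : ℕ} {e : B.E n} (h : IsMin e) :
    edgeRank e + 1 = q (n + 1) := by
  have hlt := hq.edgeRank_lt e
  obtain ⟨f, hf, hfr⟩ := hq.exists_edgeRank_eq (B.tgt e) (k := q (n + 1) - 1) (by omega)
  rcases lt_or_eq_or_gt_of_tgt_eq hf with h' | rfl | h'
  · exact absurd h' (not_lt_of_ge (h h'.le))
  · omega
  · have := edgeRank_lt_edgeRank h'
    omega

theorem IsToeplitz.edgeRank_eq_of_covBy {n : ℕ} {e f : B.E n} (h : e ⋖ f) :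
    edgeRank e = edgeRank f + 1 := by
  have hlt := edgeRank_lt_edgeRank h.lt
  by_contra hne
  have htgt := tgt_eq_of_le h.le
  obtain ⟨g, hg, hgr⟩ := hq.exists_edgeRank_eq (B.tgt e) (k := edgeRank f + 1)
    (by have := hq.edgeRank_lt e; omega)
  exact h.2 ((lt_iff_edgeRank_lt hg.symm).2 (by omega))
    ((lt_iff_edgeRank_lt (hg.trans htgt)).2 (by omega))

theorem IsToeplitz.q_pos (n : ℕ) : 0 < q (n + 1) := by
  obtain ⟨e⟩ : Nonempty (B.E n) := by
    obtain ⟨y, -⟩ := exists_tau_eq 0 (default : B.V 0)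
    exact ⟨y.1 n⟩
  exact (Nat.zero_le _).trans_lt (hq.edgeRank_lt e)

theorem IsToeplitz.qProd_pos (m n : ℕ) : 0 < qProd q m n := by
  refine Finset.prod_pos fun i hi => ?_
  obtain ⟨j, rfl⟩ : ∃ j, i = j + 1 := ⟨i - 1, by have := (Finset.mem_Ioc.1 hi).1; omega⟩
  exact hq.q_pos j

end Toeplitz

/-! ### Position of a path in a tower -/

/-- The position, counted from the top, of the segment of `x` between the levels `m` and `n` among
the paths with the same end-point. -/
noncomputable def addr (q : ℕ → ℕ) (m n : ℕ) (x : B.Path) : ℕ :=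
  ∑ i ∈ Finset.Ico m n, qProd q m i * edgeRank (x.1 i)

theorem addr_self (q : ℕ → ℕ) (m : ℕ) (x : B.Path) : addr q m m x = 0 := by simp [addr]

theorem addr_succ (q : ℕ → ℕ) {m n : ℕ} (h : m ≤ n) (x : B.Path) :
    addr q m (n + 1) x = addr q m n x + qProd q m n * edgeRank (x.1 n) := by
  simp [addr, Finset.sum_Ico_succ_top h]

theorem addr_add (q : ℕ → ℕ) {l m n : ℕ} (h : l ≤ m) (h' : m ≤ n) (x : B.Path) :
    addr q l n x = addr q l m x + qProd q l m * addr q m n x := by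
  rw [addr, addr, addr, ← Finset.sum_Ico_consecutive _ h h', Finset.mul_sum]
  congr 1
  refine Finset.sum_congr rfl fun i hi => ?_
  rw [← qProd_mul_qProd q h (Finset.mem_Ico.1 hi).1, mul_assoc]

theorem addr_congr (q : ℕ → ℕ) {m n : ℕ} {x y : B.Path}
    (h : ∀ i, m ≤ i → i < n → x.1 i = y.1 i) : addr q m n x = addr q m n y := by
  refine Finset.sum_congr rfl fun i hi => ?_
  rw [h i (Finset.mem_Ico.1 hi).1 (Finset.mem_Ico.1 hi).2]

theorem addr_eq_zero_of_isMax (q : ℕ → ℕ) {m n : ℕ} {x : B.Path}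
    (h : ∀ i, m ≤ i → i < n → IsMax (x.1 i)) : addr q m n x = 0 := by
  refine Finset.sum_eq_zero fun i hi => ?_
  rw [edgeRank_eq_zero_of_isMax (h i (Finset.mem_Ico.1 hi).1 (Finset.mem_Ico.1 hi).2), mul_zero]

section Toeplitz

variable {q : ℕ → ℕ} (hq : B.IsToeplitz q)
include hq

theorem IsToeplitz.isMax_of_addr_eq_zero {m n : ℕ} {x : B.Path} (h : addr q m n x = 0) (i : ℕ)
    (hi : m ≤ i) (hi' : i < n) : IsMax (x.1 i) := by
  have := (Finset.sum_eq_zero_iff.1 h) i (Finset.mem_Ico.2 ⟨hi, hi'⟩)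
  have hpos := hq.qProd_pos m i
  exact isMax_of_edgeRank_eq_zero ((Nat.mul_eq_zero.1 this).resolve_left hpos.ne')

theorem IsToeplitz.addr_add_one_of_isMin {m n : ℕ} (hmn : m ≤ n) {x : B.Path}
    (h : ∀ i, m ≤ i → i < n → IsMin (x.1 i)) : addr q m n x + 1 = qProd q m n := by
  induction n, hmn using Nat.le_induction with
  | base => simp [addr_self, qProd_self]
  | succ n hmn ih =>
    have h1 := ih fun i hi hi' => h i hi (by omega)
    rw [addr_succ q hmn, qProd_succ q hmn,
      ← hq.edgeRank_add_one_of_isMin (h n hmn (by omega)), ← h1]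
    ring

theorem IsToeplitz.addr_lt {m n : ℕ} (hmn : m ≤ n) (x : B.Path) :
    addr q m n x < qProd q m n := by
  induction n, hmn using Nat.le_induction with
  | base => simp [addr_self, qProd_self]
  | succ n hmn ih =>
    rw [addr_succ q hmn, qProd_succ q hmn]
    calc addr q m n x + qProd q m n * edgeRank (x.1 n)
        < qProd q m n + qProd q m n * edgeRank (x.1 n) := by gcongr
      _ = qProd q m n * (edgeRank (x.1 n) + 1) := by ring
      _ ≤ qProd q m n * q (n + 1) := Nat.mul_le_mul_left _ (hq.edgeRank_lt _)

theorem IsToeplitz.eq_of_addr_eq {m n : ℕ} (hmn : m ≤ n) {x y : B.Path}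
    (hτ : B.tau n x = B.tau n y) (h : addr q m n x = addr q m n y) (i : ℕ) (hi : m ≤ i)
    (hi' : i < n) : x.1 i = y.1 i := by
  induction n, hmn using Nat.le_induction with
  | base => omega
  | succ n hmn ih =>
    rw [addr_succ q hmn, addr_succ q hmn] at h
    obtain ⟨h1, h2⟩ := eq_and_eq_of_add_mul_eq (hq.addr_lt hmn x) (hq.addr_lt hmn y) h
    rw [tau_succ, tau_succ] at hτ
    have hn := eq_of_edgeRank_eq hτ h2
    rcases Nat.lt_succ_iff_lt_or_eq.1 hi' with hi' | rfl
    · exact ih (by rw [tau, tau, hn]) h1 hi'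
    · exact hn

/-- Every number below `qProd q m n` has a mixed-radix expansion: the quotient by `qProd q m n`
gives the rank of the last edge, the remainder the rest. Edges from level `n` on are left untouched,
so the end-point is kept. -/
theorem IsToeplitz.exists_addr_eq {m n : ℕ} (hmn : m ≤ n) (x : B.Path) {k : ℕ}
    (hk : k < qProd q m n) :
    ∃ y : B.Path, (∀ i ≥ n, y.1 i = x.1 i) ∧ addr q m n y = k := by
  induction n, hmn using Nat.le_induction generalizing x k with
  | base =>
    rw [qProd_self] at hk
    exact ⟨x, fun _ _ => rfl, by rw [addr_self]; omega⟩
  | succ n hmn ih =>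
    rw [qProd_succ q hmn] at hk
    obtain ⟨e, he, her⟩ := hq.exists_edgeRank_eq (B.tau (n + 1) x)
      (k := k / qProd q m n) (Nat.div_lt_of_lt_mul hk)
    obtain ⟨z, hz, hzx⟩ := exists_path_through x n e he
    obtain ⟨y, hy, hyk⟩ := ih z (Nat.mod_lt k (hq.qProd_pos m n))
    refine ⟨y, fun i hi => (hy i (by omega)).trans (hzx i hi), ?_⟩
    rw [addr_succ q hmn, hyk, hy n le_rfl, hz, her, Nat.mod_add_div]

theorem IsToeplitz.addr_lt_addr {m n : ℕ} {x y : B.Path}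
    (h : ∃ i, m ≤ i ∧ i < n ∧ (∀ j, i < j → j < n → x.1 j = y.1 j) ∧ x.1 i < y.1 i) :
    addr q m n y < addr q m n x := by
  obtain ⟨i, hmi, hin, heq, hlt⟩ := h
  have h3 : addr q (i + 1) n x = addr q (i + 1) n y :=
    addr_congr q fun j hj hj' => heq j (by omega) hj'
  rw [addr_add q (hmi.trans (Nat.le_add_right i 1)) hin y, addr_add q (hmi.trans (Nat.le_add_right i 1)) hin x, h3, addr_succ q hmi, addr_succ q hmi]
  have h1 := hq.addr_lt hmi y
  have h2 := Nat.mul_le_mul_left (qProd q m i) (edgeRank_lt_edgeRank hlt)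
  rw [Nat.succ_eq_add_one, mul_add] at h2
  omega

theorem IsToeplitz.exists_of_addr_lt_addr {m n : ℕ} (hmn : m ≤ n) {x y : B.Path}
    (hτ : B.tau n x = B.tau n y) (h : addr q m n y < addr q m n x) :
    ∃ i, m ≤ i ∧ i < n ∧ (∀ j, i < j → j < n → x.1 j = y.1 j) ∧ x.1 i < y.1 i := by
  induction n, hmn using Nat.le_induction with
  | base => simp [addr_self] at h
  | succ n hmn ih =>
    rw [tau_succ, tau_succ] at hτ
    rcases lt_or_eq_or_gt_of_tgt_eq hτ with h' | h' | h'
    · exact ⟨n, hmn, by omega, fun j hj hj' => by omega, h'⟩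
    · rw [addr_succ q hmn, addr_succ q hmn, h'] at h
      obtain ⟨i, hmi, hin, heq, hlt⟩ := ih (by rw [tau, tau, h']) (by omega)
      refine ⟨i, hmi, by omega, fun j hj hj' => ?_, hlt⟩
      rcases Nat.lt_succ_iff_lt_or_eq.1 hj' with hj' | rfl
      · exact heq j hj hj'
      · exact h'
    · exact absurd h (hq.addr_lt_addr
        ⟨n, hmn, by omega, fun j hj hj' => by omega, h'⟩).not_gt

/-- The order on segments with a common end-point is the reverse of the order of the addresses, and
all addresses occur. The bigger segments thus correspond bijectively to the numbers below `addr q m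
n x`. -/
theorem IsToeplitz.suffix_eq_addr (m n : ℕ) (x : B.Path) : B.suffix m n x = addr q m n x := by
  rcases le_or_gt n m with hnm | hmn
  · have : IsEmpty {p : B.FinPath m n // p.SameEnd (x.segment m n) ∧ (x.segment m n).Lt p} :=
      ⟨fun ⟨_, _, i, _⟩ => by have := i.2.1; have := i.2.2; omega⟩
    rw [suffix, Nat.card_of_isEmpty, addr, Finset.Ico_eq_empty_of_le hnm, Finset.sum_empty]
  obtain ⟨l, rfl⟩ : ∃ l, n = l + 1 := ⟨n - 1, by omega⟩
  have hex : ∀ k : Fin (addr q m (l + 1) x),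
      ∃ y : B.Path, (∀ i ≥ l + 1, y.1 i = x.1 i) ∧ addr q m (l + 1) y = k := fun k =>
    hq.exists_addr_eq hmn.le x (k.2.trans (hq.addr_lt hmn.le x))
  choose y hy hyk using hex
  have hτ : ∀ k, B.tau (l + 1) x = B.tau (l + 1) (y k) := fun k => (tau_eq_of_forall_ge (hy k)).symm
  let g : Fin (addr q m (l + 1) x) →
      {p : B.FinPath m (l + 1) // p.SameEnd (x.segment m (l + 1)) ∧ (x.segment m (l + 1)).Lt p} := fun k =>
    ⟨(y k).segment m (l + 1), by
      constructor
      · intro i hi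
        obtain ⟨i, hi'⟩ := i
        obtain rfl : i = l := by simpa using hi
        change B.tgt ((y k).1 i) = B.tgt (x.1 i)
        rw [← tau_succ, ← tau_succ, hτ k]
      · obtain ⟨i, hmi, hin, heq, hlt⟩ :=
          hq.exists_of_addr_lt_addr hmn.le (hτ k) (by rw [hyk]; exact k.2)
        exact ⟨⟨i, hmi, hin⟩, fun j hj => heq j hj j.2.2, hlt⟩⟩
  have hseg : ∀ {u v : B.Path}, u.segment m (l + 1) = v.segment m (l + 1) →
      ∀ i, m ≤ i → i < l + 1 → u.1 i = v.1 i := fun h i hi hi' =>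
    congrFun (congrArg Subtype.val h) ⟨i, hi, hi'⟩
  have hg : Function.Bijective g := by
    constructor
    · intro k l hkl
      have := addr_congr q (hseg (congrArg Subtype.val hkl))
      rw [hyk, hyk] at this
      exact Fin.ext this
    · rintro ⟨p, hend, i, heq, hlt⟩
      obtain ⟨z, rfl⟩ := exists_segment_eq hmn p
      have hzτ : B.tau (l + 1) z = B.tau (l + 1) x := by
        rw [tau_succ, tau_succ]
        exact hend ⟨l, by simp only [Set.mem_Ico]; omega⟩ rfl
      have hzlt : addr q m (l + 1) z < addr q m (l + 1) x := hq.addr_lt_addr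
        ⟨i, i.2.1, i.2.2, fun j hj hj' => heq ⟨j, i.2.1.trans hj.le, hj'⟩ hj, hlt⟩
      refine ⟨⟨_, hzlt⟩, Subtype.ext (Subtype.ext (funext fun j => ?_))⟩
      exact hq.eq_of_addr_eq hmn.le ((hτ _).symm.trans hzτ.symm) (hyk _) j j.2.1 j.2.2
  rw [suffix, ← Nat.card_eq_of_bijective g hg, Nat.card_eq_fintype_card, Fintype.card_fin]

/-- The Vershik map moves a path one step towards the top of its tower of level `n`, unless the
path is already at the top, in which case its image is at the bottom of a tower. -/
theorem IsToeplitz.addr_of_vershikRel {x y : B.Path} (h : B.VershikRel x y) (n : ℕ) :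
    (addr q 0 n x = addr q 0 n y + 1 ∧ ∀ i ≥ n, y.1 i = x.1 i) ∨
      (addr q 0 n x = 0 ∧ addr q 0 n y + 1 = qProd q 0 n) := by
  rcases h with ⟨k, hmax, hcov, hmin, heq⟩ | ⟨hmax, hmin⟩
  -- Subtraction with borrow: below `k` the digits of `x` vanish and those of `y` are as large as
  -- possible, while digit `k` drops by one. If `k ≥ n` the truncation to level `n` only sees the
  -- passage from top to bottom.
  · rcases lt_or_ge k n with hk | hk
    · refine Or.inl ⟨?_, fun i hi => heq i (by omega)⟩
      have h3 : addr q (k + 1) n x = addr q (k + 1) n y :=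
        addr_congr q fun j hj _ => (heq j (by omega)).symm
      rw [addr_add q (Nat.zero_le (k + 1)) hk y, addr_add q (Nat.zero_le (k + 1)) hk x, h3,
        addr_succ q (Nat.zero_le k),
        addr_succ q (Nat.zero_le k), addr_eq_zero_of_isMax q fun i _ hi => hmax i hi,
        hq.edgeRank_eq_of_covBy hcov, mul_add, ← hq.addr_add_one_of_isMin (Nat.zero_le k)
          fun i _ hi => hmin i hi]
      ring
    · exact Or.inr ⟨addr_eq_zero_of_isMax q fun i _ hi => hmax i (by omega),
        hq.addr_add_one_of_isMin (Nat.zero_le n) fun i _ hi => hmin i (by omega)⟩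
  · exact Or.inr ⟨addr_eq_zero_of_isMax q fun i _ _ => hmax i,
      hq.addr_add_one_of_isMin (Nat.zero_le n) fun i _ _ => hmin i⟩

theorem IsToeplitz.mem_suffixFinset {m n : ℕ} {t₁ : B.V m} {t₂ : B.V n} {s : ℕ} :
    s ∈ B.suffixFinset m n t₁ t₂ ↔
      ∃ x : B.Path, B.tau m x = t₁ ∧ B.tau n x = t₂ ∧ addr q m n x = s := by
  simp [suffixFinset, suffixSet, hq.suffix_eq_addr]

/-- Inside a tower the address determines the segment, hence its starting vertex. The suffix sets
with a fixed end-point are therefore disjoint and detect `tau m`. -/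
theorem IsToeplitz.addr_mem_suffixFinset_iff {m n : ℕ} (hmn : m < n) {t₁ : B.V m} {x : B.Path} :
    addr q m n x ∈ B.suffixFinset m n t₁ (B.tau n x) ↔ B.tau m x = t₁ := by
  rw [hq.mem_suffixFinset]
  refine ⟨fun ⟨y, hy, hτ, hs⟩ => ?_, fun h => ⟨x, h, rfl, rfl⟩⟩
  rw [← hy, tau, tau, hq.eq_of_addr_eq hmn.le hτ hs m le_rfl hmn]

end Toeplitz

end OrderedBratteliDiagram

/-! ### Separation of roots of unity. -/

theorem exists_separation_of_pow_eq_one {b : ℕ} (hb : 0 < b) :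
    ∃ κ : ℝ, 0 < κ ∧ ∀ z w : ℂ, z ^ b = 1 → w ^ b = 1 → ‖z - w‖ < κ → z = w := by
  classical
  let S := Polynomial.nthRootsFinset b (1 : ℂ)
  have hmem : ∀ z w : ℂ, z ^ b = 1 → w ^ b = 1 → z ≠ w → (z, w) ∈ S.offDiag :=
    fun z w hz hw hne => Finset.mem_offDiag.2
      ⟨(Polynomial.mem_nthRootsFinset hb _).2 hz, (Polynomial.mem_nthRootsFinset hb _).2 hw, hne⟩
  rcases S.offDiag.eq_empty_or_nonempty with hS | hS
  · refine ⟨1, one_pos, fun z w hz hw _ => by_contra fun hne => ?_⟩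
    simpa [hS] using hmem z w hz hw hne
  · obtain ⟨p, hp, hmin⟩ := S.offDiag.exists_min_image (fun p => ‖p.1 - p.2‖) hS
    refine ⟨‖p.1 - p.2‖, norm_pos_iff.2 (sub_ne_zero.2 (Finset.mem_offDiag.1 hp).2.2),
      fun z w hz hw hlt => by_contra fun hne => ?_⟩
    exact (hmin _ (hmem z w hz hw hne)).not_gt hlt

namespace OrderedBratteliDiagram

variable {B : OrderedBratteliDiagram}

/-! ### Topology of the path space -/

theorem continuous_edge (i : ℕ) : @Continuous B.Path (B.E i) _ ⊥ fun x => x.1 i := by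
  let : ∀ i, TopologicalSpace (B.E i) := fun _ => ⊥
  exact (continuous_apply (A := B.E) i).comp continuous_induced_dom

theorem isOpen_cylinder (n : ℕ) (x : B.Path) : IsOpen {y : B.Path | ∀ i < n, x.1 i = y.1 i} := by
  have : {y : B.Path | ∀ i < n, x.1 i = y.1 i} =
      ⋂ i ∈ Finset.range n, (fun y : B.Path => y.1 i) ⁻¹' {x.1 i} := by
    ext y
    simp [eq_comm]
  rw [this]
  refine isOpen_biInter_finset fun i _ => ?_
  let : TopologicalSpace (B.E i) := ⊥
  have : DiscreteTopology (B.E i) := ⟨rfl⟩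
  exact (isOpen_discrete _).preimage (continuous_edge i)

theorem isOpen_of_cylinder (n : ℕ) {S : Set B.Path}
    (h : ∀ x y : B.Path, (∀ i < n, x.1 i = y.1 i) → x ∈ S → y ∈ S) : IsOpen S := by
  refine isOpen_iff_forall_mem_open.2 fun x hx =>
    ⟨_, fun y hy => h x y hy hx, isOpen_cylinder n x, fun i _ => rfl⟩

theorem exists_cylinder_subset {U : Set B.Path} (hU : IsOpen U) {x : B.Path} (hx : x ∈ U) :
    ∃ n, ∀ y : B.Path, (∀ i < n, x.1 i = y.1 i) → y ∈ U := by
  let : ∀ i, TopologicalSpace (B.E i) := fun _ => ⊥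
  obtain ⟨V, hV, rfl⟩ := isOpen_induced_iff.1 hU
  obtain ⟨I, u, hu, hsub⟩ := isOpen_pi_iff.1 hV x.1 hx
  refine ⟨I.sup id + 1, fun y hy => hsub fun i hi => ?_⟩
  have : i ≤ I.sup id := Finset.le_sup (f := id) hi
  rw [← hy i (by omega)]
  exact (hu i hi).2

theorem tendsto_of_cylinder {z : ℕ → B.Path} {x : B.Path}
    (h : ∀ N, ∀ᶠ n in atTop, ∀ i < N, x.1 i = (z n).1 i) : Tendsto z atTop (𝓝 x) := by
  refine tendsto_nhds.2 fun U hU hx => ?_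
  obtain ⟨N, hN⟩ := exists_cylinder_subset hU hx
  filter_upwards [h N] with n hn using hN _ hn

theorem continuous_of_cylinder {Y : Type*} [TopologicalSpace Y] (n : ℕ) {g : B.Path → Y}
    (h : ∀ x y : B.Path, (∀ i < n, x.1 i = y.1 i) → g x = g y) : Continuous g :=
  continuous_def.2 fun s _ => isOpen_of_cylinder n fun x y hxy hx => by
    rwa [Set.mem_preimage, ← h x y hxy]

theorem measurable_of_cylinder {Y : Type*} [MeasurableSpace Y] (n : ℕ) {g : B.Path → Y}
    (h : ∀ x y : B.Path, (∀ i < n, x.1 i = y.1 i) → g x = g y) : Measurable g := fun s _ =>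
  (isOpen_of_cylinder n fun x y hxy hx => by
    rwa [Set.mem_preimage, ← h x y hxy] : IsOpen (g ⁻¹' s)).measurableSet

theorem continuous_addr (q : ℕ → ℕ) (m n : ℕ) : Continuous (addr (B := B) q m n) :=
  continuous_of_cylinder n fun _ _ h => addr_congr q fun i _ hi => h i hi

theorem measurable_addr (q : ℕ → ℕ) (m n : ℕ) : Measurable (addr (B := B) q m n) :=
  (continuous_addr q m n).measurable

theorem measurableSet_tau_eq (n : ℕ) (v : B.V n) : MeasurableSet {x | B.tau n x = v} :=
  (isOpen_of_cylinder (n + 1) fun x y h hx => by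
    rw [Set.mem_ofPred_eq, ← hx, tau, tau, h n n.lt_succ_self]).measurableSet

/-! ### The position in a tower along an orbit -/

section Toeplitz

variable {q : ℕ → ℕ} (hq : B.IsToeplitz q) (hB : B.IsProperlyOrdered)
include hq

theorem IsToeplitz.addr_vershik (n : ℕ) (x : B.Path) :
    (addr q 0 n x = addr q 0 n (B.vershik hB x) + 1 ∧
        B.tau n (B.vershik hB x) = B.tau n x) ∨
      (addr q 0 n x = 0 ∧ addr q 0 n (B.vershik hB x) + 1 = qProd q 0 n) :=
  (hq.addr_of_vershikRel (B.vershik_spec hB x) n).imp_left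
    fun h => ⟨h.1, tau_eq_of_forall_ge h.2⟩

theorem IsToeplitz.addr_iterate_modEq (n k : ℕ) (x : B.Path) :
    addr q 0 n ((B.vershik hB)^[k] x) + k ≡ addr q 0 n x [MOD qProd q 0 n] := by
  induction k with
  | zero => rfl
  | succ k ih =>
    refine Nat.ModEq.trans ?_ ih
    rw [Function.iterate_succ_apply', ← add_assoc, add_right_comm]
    refine Nat.ModEq.add_right k ?_
    rcases hq.addr_vershik hB n ((B.vershik hB)^[k] x) with h | h
    · rw [h.1]
    · rw [h.1, h.2]
      simp [Nat.ModEq]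

theorem IsToeplitz.addr_iterate_qProd (n : ℕ) (x : B.Path) :
    addr q 0 n ((B.vershik hB)^[qProd q 0 n] x) = addr q 0 n x := by
  refine Nat.ModEq.eq_of_lt_of_lt ?_ (hq.addr_lt (Nat.zero_le n) _)
    (hq.addr_lt (Nat.zero_le n) _)
  exact (by simp [Nat.ModEq] : addr q 0 n ((B.vershik hB)^[qProd q 0 n] x) ≡ _ [MOD _]).trans
    (hq.addr_iterate_modEq hB n (qProd q 0 n) x)

theorem IsToeplitz.addr_iterate_addr (n : ℕ) (x : B.Path) :
    addr q 0 n ((B.vershik hB)^[addr q 0 n x] x) = 0 := by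
  have h := hq.addr_iterate_modEq hB n (addr q 0 n x) x
  refine Nat.ModEq.eq_of_lt_of_lt (m := qProd q 0 n) ?_ (hq.addr_lt (Nat.zero_le n) _)
    (hq.qProd_pos 0 n)
  exact Nat.ModEq.add_right_cancel' (addr q 0 n x) (by rwa [zero_add])

/-- Both paths have maximal edges up to index `n + 1`. The edges of index `n + 1` start in the same
vertex by `max_src`, and from a given vertex there is only one way back to the root through maximal
edges. The extra level is the price for using `max_src`. -/
theorem IsToeplitz.eq_of_addr_eq_zero {d : ℕ} {label : ∀ n, Fin d → B.V n}
    (hproper : B.IsProper label) {n : ℕ} {x y : B.Path} (hx : addr q 0 (n + 2) x = 0)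
    (hy : addr q 0 (n + 2) y = 0) (i : ℕ) (hi : i < n + 1) : x.1 i = y.1 i := by
  have hxm := hq.isMax_of_addr_eq_zero hx
  have hym := hq.isMax_of_addr_eq_zero hy
  refine hq.eq_of_addr_eq (Nat.zero_le (n + 1)) ?_ ?_ i (Nat.zero_le i) hi
  · exact hproper.max_src (n + 1) (by omega) _ _ (hxm _ (by omega) (by omega))
      (hym _ (by omega) (by omega))
  · rw [addr_eq_zero_of_isMax q fun i _ hi => hxm i (by omega) (by omega),
      addr_eq_zero_of_isMax q fun i _ hi => hym i (by omega) (by omega)]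

/-! ### Continuous eigenvalues -/

theorem IsToeplitz.isContinuousEigenvalue_of_pow_eq_one {lam : ℂ} (hlam : lam ≠ 0) {n : ℕ}
    (h : lam ^ qProd q 0 n = 1) : IsContinuousEigenvalue (B.vershik hB) lam := by
  refine ⟨fun x => (lam ^ addr q 0 n x)⁻¹,
    continuous_of_cylinder n fun x y hxy => by rw [addr_congr q fun i _ hi => hxy i hi],
    fun h0 => ?_, fun x => ?_⟩
  · obtain ⟨x, -⟩ := hB.1
    exact inv_ne_zero (pow_ne_zero _ hlam) (congrFun h0 x)
  · change (lam ^ addr q 0 n (B.vershik hB x))⁻¹ = lam * (lam ^ addr q 0 n x)⁻¹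
    rcases hq.addr_vershik hB n x with h' | h'
    · rw [h'.1, pow_succ]
      field_simp
    · rw [← h'.2, pow_succ] at h
      rw [h'.1, pow_zero, inv_one, mul_one]
      exact inv_eq_of_mul_eq_one_right h

/-- Let `z n` be the top reached from `y` in the tower of level `n`. Both `z n` and its image under
`qProd q 0 n` steps are tops, so both converge to the maximal path. The quotient of the values of
`f` there is `lam ^ qProd q 0 n`, and `‖f (z n)‖` stays equal to `‖f y‖ ≠ 0`. -/
theorem IsToeplitz.tendsto_pow_of_isContinuousEigenvalue {d : ℕ} {label : ∀ n, Fin d → B.V n}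
    (hproper : B.IsProper label) {lam : ℂ} (hlam : ‖lam‖ = 1)
    (h : IsContinuousEigenvalue (B.vershik hB) lam) :
    Tendsto (fun n => lam ^ qProd q 0 n) atTop (𝓝 1) := by
  obtain ⟨f, hf, hf0, hfT⟩ := h
  obtain ⟨y, hy⟩ := Function.ne_iff.1 hf0
  obtain ⟨xm, hxm, -⟩ := hB.1
  have hiter : ∀ k x, f ((B.vershik hB)^[k] x) = lam ^ k * f x := by
    intro k
    induction k with
    | zero => simp
    | succ k ih => intro x; rw [Function.iterate_succ_apply', hfT, ih, pow_succ]; ring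
  have htop : ∀ z : ℕ → B.Path, (∀ n, addr q 0 n (z n) = 0) → Tendsto z atTop (𝓝 xm) := by
    refine fun z hz => tendsto_of_cylinder fun N => ?_
    filter_upwards [eventually_ge_atTop (N + 2)] with n hn i hi
    obtain ⟨k, rfl⟩ : ∃ k, n = k + 2 := ⟨n - 2, by omega⟩
    exact hq.eq_of_addr_eq_zero hproper (addr_eq_zero_of_isMax q fun j _ _ => hxm j) (hz _) i
      (by omega)
  let z : ℕ → B.Path := fun n => (B.vershik hB)^[addr q 0 n y] y
  have hz : ∀ n, addr q 0 n (z n) = 0 := fun n => hq.addr_iterate_addr hB n y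
  have h1 : Tendsto (fun n => f (z n)) atTop (𝓝 (f xm)) := (hf.tendsto xm).comp (htop z hz)
  have h2 : Tendsto (fun n => f ((B.vershik hB)^[qProd q 0 n] (z n))) atTop (𝓝 (f xm)) :=
    (hf.tendsto xm).comp (htop _ fun n => by rw [hq.addr_iterate_qProd, hz])
  have hnorm : ∀ n, ‖f (z n)‖ = ‖f y‖ := fun n => by simp [z, hiter, hlam]
  have hne : ∀ n, f (z n) ≠ 0 := fun n => by
    rw [← norm_ne_zero_iff, hnorm]; exact norm_ne_zero_iff.2 hy
  have hm : f xm ≠ 0 := by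
    have : ‖f xm‖ = ‖f y‖ :=
      tendsto_nhds_unique h1.norm (by simp only [hnorm]; exact tendsto_const_nhds)
    rw [← norm_ne_zero_iff, this]; exact norm_ne_zero_iff.2 hy
  have h3 := h2.div h1 hm
  rw [div_self hm] at h3
  refine h3.congr fun n => ?_
  simp only [Pi.div_apply, hiter]
  exact mul_div_cancel_right₀ _ (hne n)

theorem IsToeplitz.isContinuousEigenvalue_iff {d : ℕ} {label : ∀ n, Fin d → B.V n}
    (hproper : B.IsProper label) {lam : ℂ} {b : ℕ} (hb : 0 < b) (hlam : lam ^ b = 1) :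
    IsContinuousEigenvalue (B.vershik hB) lam ↔ ∃ n, lam ^ qProd q 0 n = 1 := by
  refine ⟨fun h => ?_, fun ⟨n, h⟩ => hq.isContinuousEigenvalue_of_pow_eq_one hB
    (fun h0 => by simp [h0, hb.ne'] at hlam) h⟩
  have ht := hq.tendsto_pow_of_isContinuousEigenvalue hB hproper
    (Complex.norm_eq_one_of_pow_eq_one hlam hb.ne') h
  obtain ⟨κ, hκ, hsep⟩ := exists_separation_of_pow_eq_one hb
  obtain ⟨n, hn⟩ := (Metric.tendsto_nhds.1 ht κ hκ).exists
  exact ⟨n, hsep _ 1 (by rw [← pow_mul, mul_comm, pow_mul, hlam, one_pow]) (one_pow b)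
    (by rwa [dist_eq_norm] at hn)⟩

end Toeplitz

end OrderedBratteliDiagram

/-! ### Block sums and splitting of integrals over fibres. -/

theorem sum_range_mul_div {M : Type*} [AddCommMonoid M] (g : ℕ → M) {p : ℕ} (hp : 0 < p) (r : ℕ) :
    ∑ k ∈ Finset.range (p * r), g (k / p) = p • ∑ s ∈ Finset.range r, g s := by
  induction r with
  | zero => simp
  | succ r ih =>
    rw [mul_add, mul_one, Finset.sum_range_add, ih, Finset.sum_range_succ, smul_add]
    congr 1
    rw [Finset.sum_congr rfl fun k hk => by
      rw [Nat.mul_add_div hp, Nat.div_eq_of_lt (Finset.mem_range.1 hk), add_zero]]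
    simp

theorem integral_eq_sum_setIntegral_fiber {X ι F : Type*} [MeasurableSpace X]
    [NormedAddCommGroup F] [NormedSpace ℝ F] {μ : Measure X} {g : X → ι} (t : Finset ι)
    (hg : ∀ i ∈ t, MeasurableSet {x | g x = i}) (hgt : ∀ x, g x ∈ t) {ψ : X → F}
    (hψ : Integrable ψ μ) : ∫ x, ψ x ∂μ = ∑ i ∈ t, ∫ x in {x | g x = i}, ψ x ∂μ := by
  rw [← integral_biUnion_finset t hg
    (fun i _ j _ hij => Set.disjoint_left.2 fun x hi hj => hij (hi.symm.trans hj))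
    fun i _ => hψ.integrableOn]
  have : ⋃ i ∈ t, {x | g x = i} = Set.univ := by
    ext x
    simpa using hgt x
  rw [this, setIntegral_univ]

namespace OrderedBratteliDiagram

variable {B : OrderedBratteliDiagram} {q : ℕ → ℕ} (hq : B.IsToeplitz q)
  (hB : B.IsProperlyOrdered) {μ : Measure B.Path}
include hq

/-! ### Integration over the levels of a tower -/

theorem IsToeplitz.setIntegral_addr_succ {F : Type*} [NormedAddCommGroup F] [NormedSpace ℝ F]
    (hT : MeasurePreserving (B.vershik hB) μ μ) (n : ℕ) {ψ : B.Path → F}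
    (hψ : AEStronglyMeasurable ψ μ)
    (h : ∀ᵐ x ∂μ, addr q 0 n x ≠ 0 → ψ (B.vershik hB x) = ψ x) {k : ℕ}
    (hk : k + 1 < qProd q 0 n) :
    ∫ x in {x | addr q 0 n x = k + 1}, ψ x ∂μ = ∫ x in {x | addr q 0 n x = k}, ψ x ∂μ := by
  have hS : ∀ k, MeasurableSet {x : B.Path | addr q 0 n x = k} := fun k =>
    measurable_addr q 0 n (measurableSet_singleton k)
  have hpre : B.vershik hB ⁻¹' {x | addr q 0 n x = k} = {x | addr q 0 n x = k + 1} := by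
    ext x
    simp only [Set.mem_preimage, Set.mem_ofPred_eq]
    rcases hq.addr_vershik hB n x with h' | h' <;> omega
  have hψ' : AEStronglyMeasurable ψ (Measure.map (B.vershik hB) μ) := by rwa [hT.map_eq]
  have := setIntegral_map (hS k) hψ' hT.measurable.aemeasurable
  rw [hT.map_eq, hpre] at this
  rw [this]
  refine setIntegral_congr_ae (hS _) ?_
  filter_upwards [h] with x hx hxk
  exact (hx (by rw [hxk]; exact k.succ_ne_zero)).symm

/-- The preimage of level `k` under the Vershik map is level `k + 1`, so a function which is
invariant off the top level has the same integral over each of the `qProd q 0 n` levels. -/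
theorem IsToeplitz.setIntegral_addr_eq {F : Type*} [NormedAddCommGroup F] [NormedSpace ℝ F]
    (hT : MeasurePreserving (B.vershik hB) μ μ) (n : ℕ) {ψ : B.Path → F} (hψ : Integrable ψ μ)
    (h : ∀ᵐ x ∂μ, addr q 0 n x ≠ 0 → ψ (B.vershik hB x) = ψ x) {k : ℕ}
    (hk : k < qProd q 0 n) :
    (qProd q 0 n : ℝ) • ∫ x in {x | addr q 0 n x = k}, ψ x ∂μ = ∫ x, ψ x ∂μ := by
  have h0 : ∀ k < qProd q 0 n, ∫ x in {x | addr q 0 n x = k}, ψ x ∂μ =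
      ∫ x in {x | addr q 0 n x = 0}, ψ x ∂μ := by
    intro k
    induction k with
    | zero => exact fun _ => rfl
    | succ k ih =>
      intro hk
      rw [hq.setIntegral_addr_succ hB hT n hψ.aestronglyMeasurable h hk, ih (by omega)]
  rw [integral_eq_sum_setIntegral_fiber (g := addr q 0 n) (Finset.range (qProd q 0 n))
    (fun i _ => measurable_addr q 0 n (measurableSet_singleton i))
    (fun x => Finset.mem_range.2 (hq.addr_lt (Nat.zero_le n) x)) hψ,
    Finset.sum_congr rfl fun i hi => h0 i (Finset.mem_range.1 hi), h0 k hk, Finset.sum_const,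
    Finset.card_range, Nat.cast_smul_eq_nsmul]

variable [IsProbabilityMeasure μ]

theorem IsToeplitz.measureReal_addr_eq (hT : MeasurePreserving (B.vershik hB) μ μ) (n : ℕ) {k : ℕ}
    (hk : k < qProd q 0 n) : μ.real {x | addr q 0 n x = k} = (qProd q 0 n : ℝ)⁻¹ := by
  have h := hq.setIntegral_addr_eq hB hT n (ψ := fun _ => (1 : ℝ)) (integrable_const _)
    (ae_of_all _ fun _ _ => rfl) hk
  simp only [integral_const, measureReal_restrict_apply_univ, smul_eq_mul, mul_one,
    probReal_univ] at h
  exact eq_inv_of_mul_eq_one_right h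

theorem IsToeplitz.measureReal_tau_eq_and_addr_eq (hT : MeasurePreserving (B.vershik hB) μ μ)
    (n : ℕ) (t : B.V n) {k : ℕ} (hk : k < qProd q 0 n) :
    μ.real ({x | addr q 0 n x = k} ∩ {x | B.tau n x = t}) =
      μ.real {x | B.tau n x = t} / qProd q 0 n := by
  have hp : (qProd q 0 n : ℝ) ≠ 0 := Nat.cast_ne_zero.2 (hq.qProd_pos 0 n).ne'
  have h := hq.setIntegral_addr_eq hB hT n (ψ := {x | B.tau n x = t}.indicator fun _ => (1 : ℝ))
    ((integrable_const _).indicator (measurableSet_tau_eq n t))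
    (ae_of_all _ fun x hx => by
      have h := ((hq.addr_vershik hB n x).resolve_right fun h => hx h.1).2
      have hiff : B.vershik hB x ∈ {x | B.tau n x = t} ↔ x ∈ {x | B.tau n x = t} := by
        rw [Set.mem_ofPred_eq, h, Set.mem_ofPred_eq]
      by_cases ht : x ∈ {x | B.tau n x = t}
      · rw [Set.indicator_of_mem (hiff.2 ht), Set.indicator_of_mem ht]
      · rw [Set.indicator_of_notMem (hiff.not.2 ht), Set.indicator_of_notMem ht]) hk
  rw [setIntegral_indicator (measurableSet_tau_eq n t), integral_indicator
    (measurableSet_tau_eq n t)] at h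
  simp only [integral_const, measureReal_restrict_apply_univ, smul_eq_mul, mul_one] at h
  rw [← h]
  field_simp

theorem IsToeplitz.setIntegral_tau_comp_addr (hT : MeasurePreserving (B.vershik hB) μ μ) (n : ℕ)
    (t : B.V n) (g : ℕ → ℂ) :
    ∫ x in {x | B.tau n x = t}, g (addr q 0 n x) ∂μ =
      (μ.real {x | B.tau n x = t} / qProd q 0 n : ℝ) * ∑ k ∈ Finset.range (qProd q 0 n), g k := by
  have hint : Integrable (fun x => g (addr q 0 n x)) (μ.restrict {x | B.tau n x = t}) := by
    refine Integrable.of_bound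
      ((measurable_of_countable g).comp (measurable_addr q 0 n)).aestronglyMeasurable
      (∑ k ∈ Finset.range (qProd q 0 n), ‖g k‖) (ae_of_all _ fun x => ?_)
    exact Finset.single_le_sum (f := fun k => ‖g k‖) (fun _ _ => norm_nonneg _)
      (Finset.mem_range.2 (hq.addr_lt (Nat.zero_le n) x))
  have hS : ∀ k, MeasurableSet {x : B.Path | addr q 0 n x = k} := fun k =>
    measurable_addr q 0 n (measurableSet_singleton k)
  rw [integral_eq_sum_setIntegral_fiber (g := addr q 0 n) (Finset.range (qProd q 0 n))
    (fun i _ => hS i) (fun x => Finset.mem_range.2 (hq.addr_lt (Nat.zero_le n) x)) hint,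
    Finset.mul_sum]
  refine Finset.sum_congr rfl fun k hk => ?_
  rw [Measure.restrict_restrict (hS k), setIntegral_congr_fun (g := fun _ => g k)
    ((hS k).inter (measurableSet_tau_eq n t)) fun x hx => by
      have : addr q 0 n x = k := hx.1
      simp only [this], setIntegral_const,
    hq.measureReal_tau_eq_and_addr_eq hB hT n t (Finset.mem_range.1 hk), Complex.real_smul]

/-- On the tower of `t₂` the address from level `m` is `addr q 0 n x / qProd q 0 m`, so each of its
values is shared by `qProd q 0 m` levels of equal mass. Membership in the suffix set selects the
levels that lie over `t₁`. -/
theorem IsToeplitz.setIntegral_tau_tau_comp_addr (hT : MeasurePreserving (B.vershik hB) μ μ)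
    {m n : ℕ} (hmn : m < n) (t₁ : B.V m) (t₂ : B.V n) (φ : ℕ → ℂ) :
    ∫ x in {x | B.tau m x = t₁} ∩ {x | B.tau n x = t₂}, φ (addr q m n x) ∂μ =
      (μ.real {x | B.tau n x = t₂} / qProd q m n : ℝ) *
        ∑ s ∈ B.suffixFinset m n t₁ t₂, φ s := by
  classical
  have hp : (qProd q 0 m : ℝ) ≠ 0 := Nat.cast_ne_zero.2 (hq.qProd_pos 0 m).ne'
  have hdiv : ∀ x : B.Path, addr q 0 n x / qProd q 0 m = addr q m n x := by
    intro x
    rw [addr_add q (Nat.zero_le m) hmn.le, Nat.add_mul_div_left _ _ (hq.qProd_pos 0 m),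
      Nat.div_eq_of_lt (hq.addr_lt (Nat.zero_le m) x), zero_add]
  let g : ℕ → ℂ := fun s => if s ∈ B.suffixFinset m n t₁ t₂ then φ s else 0
  have h := hq.setIntegral_tau_comp_addr hB hT n t₂ fun k => g (k / qProd q 0 m)
  have hsub : B.suffixFinset m n t₁ t₂ ⊆ Finset.range (qProd q m n) := by
    intro s hs
    obtain ⟨x, -, -, rfl⟩ := hq.mem_suffixFinset.1 hs
    exact Finset.mem_range.2 (hq.addr_lt hmn.le x)
  have hsum : ∑ s ∈ Finset.range (qProd q m n), g s = ∑ s ∈ B.suffixFinset m n t₁ t₂, φ s := by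
    rw [← Finset.sum_filter, Finset.filter_mem_eq_inter, Finset.inter_eq_right.2 hsub]
  rw [← qProd_mul_qProd q (Nat.zero_le m) hmn.le, sum_range_mul_div g (hq.qProd_pos 0 m), hsum,
    nsmul_eq_mul, ← mul_assoc, ← Complex.ofReal_natCast (qProd q 0 m), ← Complex.ofReal_mul,
    Nat.cast_mul, div_mul_eq_mul_div, mul_comm _ (qProd q 0 m : ℝ),
    mul_div_mul_left _ _ hp] at h
  rw [← h, ← integral_indicator ((measurableSet_tau_eq m t₁).inter (measurableSet_tau_eq n t₂)),
    ← integral_indicator (measurableSet_tau_eq n t₂)]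
  refine integral_congr_ae (ae_of_all _ fun x => ?_)
  simp only [Set.indicator, Set.mem_inter_iff, Set.mem_ofPred_eq, hdiv, g]
  by_cases h2 : B.tau n x = t₂
  · subst h2
    simp only [hq.addr_mem_suffixFinset_iff hmn, and_true, if_true]
  · simp [h2]

end OrderedBratteliDiagram

namespace OrderedBratteliDiagram

/-! ### Approximation by functions of finitely many edges -/

/-- The `σ`-algebra of the sets which depend only on the first `n` edges of a path. -/
@[reducible]
def cylinderSpace (B : OrderedBratteliDiagram) (n : ℕ) : MeasurableSpace B.Path where
  MeasurableSet' S := ∀ x y : B.Path, (∀ i < n, x.1 i = y.1 i) → (x ∈ S ↔ y ∈ S)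
  measurableSet_empty _ _ _ := Iff.rfl
  measurableSet_compl _ hS x y h := (hS x y h).not
  measurableSet_iUnion _ hS x y h := by
    simp only [Set.mem_iUnion]
    exact exists_congr fun k => hS k x y h

/-- The filtration of the path space by the sets which depend on finitely many edges. -/
def cylinderFiltration (B : OrderedBratteliDiagram) :
    Filtration ℕ (inferInstance : MeasurableSpace B.Path) where
  seq := B.cylinderSpace
  mono' _ _ hmn _ hS x y h := hS x y fun i hi => h i (hi.trans_le hmn)
  le' n _ hS := (isOpen_of_cylinder n fun x y h hx => (hS x y h).1 hx).measurableSet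

variable {B : OrderedBratteliDiagram} {μ : Measure B.Path}

/-- An open set is the union over `n` of the sets of paths whose cylinder of length `n` it contains.
This lets martingale convergence recover any integrable function from its conditional expectations.
-/
theorem le_iSup_cylinderFiltration :
    (inferInstance : MeasurableSpace B.Path) ≤ ⨆ n, B.cylinderFiltration n := by
  refine MeasurableSpace.generateFrom_le fun U hU => ?_
  have : U = ⋃ n, {x | ∀ y : B.Path, (∀ i < n, x.1 i = y.1 i) → y ∈ U} := by
    ext x
    simp only [Set.mem_iUnion, Set.mem_ofPred_eq]
    exact ⟨exists_cylinder_subset hU, fun ⟨n, hn⟩ => hn x fun _ _ => rfl⟩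
  rw [this]
  refine MeasurableSet.iUnion fun n => ?_
  refine le_iSup (fun n => B.cylinderFiltration n) n _ fun x y h => ?_
  exact ⟨fun hx z hz => hx z fun i hi => (h i hi).trans (hz i hi),
    fun hy z hz => hy z fun i hi => (h i hi).symm.trans (hz i hi)⟩

theorem exists_cylinder_integral_abs_sub_lt [IsFiniteMeasure μ] {f : B.Path → ℝ}
    (hf : Integrable f μ) {ε : ℝ} (hε : 0 < ε) :
    ∃ (n : ℕ) (g : B.Path → ℝ), (∀ x y : B.Path, (∀ i < n, x.1 i = y.1 i) → g x = g y) ∧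
      Integrable g μ ∧ ∫ x, |f x - g x| ∂μ < ε := by
  obtain ⟨f', hf', hff'⟩ := hf.aestronglyMeasurable
  have hint : Integrable f' μ := hf.congr hff'
  have ht := hint.tendsto_eLpNorm_condExp (ℱ := B.cylinderFiltration)
    (hf'.mono le_iSup_cylinderFiltration)
  obtain ⟨n, hn⟩ := ((tendsto_order.1 ht).2 (ENNReal.ofReal ε) (by simpa using hε)).exists
  refine ⟨n, μ[f'|B.cylinderFiltration n], fun x y h => ?_, integrable_condExp, ?_⟩
  -- Measurable sets of the `n`-th σ-algebra are unions of cylinders; applied to a level set of the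
  -- conditional expectation, this makes it constant on cylinders.
  · have := (stronglyMeasurable_condExp (m := B.cylinderFiltration n) (f := f')
      (μ := μ)).measurable (measurableSet_singleton ((μ[f'|B.cylinderFiltration n]) x))
    exact ((this x y h).1 rfl).symm
  · have h1 : ∫ x, |f x - (μ[f'|B.cylinderFiltration n]) x| ∂μ =
        ∫ x, ‖(μ[f'|B.cylinderFiltration n] - f') x‖ ∂μ := by
      refine integral_congr_ae ?_
      filter_upwards [hff'] with x hx
      rw [hx, abs_sub_comm, Pi.sub_apply, Real.norm_eq_abs]
    rw [h1, ← ENNReal.ofReal_lt_ofReal_iff hε,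
      ofReal_integral_norm_eq_lintegral_enorm (integrable_condExp.sub hint),
      ← eLpNorm_one_eq_lintegral_enorm]
    exact hn

theorem exists_cylinder_integral_norm_sub_lt [IsFiniteMeasure μ] {f : B.Path → ℂ}
    (hf : Integrable f μ) {ε : ℝ} (hε : 0 < ε) :
    ∃ (n : ℕ) (g : B.Path → ℂ), (∀ x y : B.Path, (∀ i < n, x.1 i = y.1 i) → g x = g y) ∧
      Integrable g μ ∧ ∫ x, ‖f x - g x‖ ∂μ < ε := by
  obtain ⟨n₁, g₁, hg₁, hi₁, h₁⟩ := exists_cylinder_integral_abs_sub_lt hf.re (half_pos hε)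
  obtain ⟨n₂, g₂, hg₂, hi₂, h₂⟩ := exists_cylinder_integral_abs_sub_lt hf.im (half_pos hε)
  have hi : Integrable (fun x => (g₁ x : ℂ) + g₂ x * Complex.I) μ :=
    hi₁.ofReal.add (hi₂.ofReal.mul_const _)
  refine ⟨max n₁ n₂, fun x => g₁ x + g₂ x * Complex.I, fun x y h => ?_, hi, ?_⟩
  · simp only [hg₁ x y fun i hi => h i (lt_max_of_lt_left hi),
      hg₂ x y fun i hi => h i (lt_max_of_lt_right hi)]
  · have hle : ∀ x, ‖f x - (g₁ x + g₂ x * Complex.I)‖ ≤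
        |RCLike.re (f x) - g₁ x| + |RCLike.im (f x) - g₂ x| := fun x => by
      refine (Complex.norm_le_abs_re_add_abs_im _).trans_eq ?_
      simp
    calc ∫ x, ‖f x - (g₁ x + g₂ x * Complex.I)‖ ∂μ
        ≤ ∫ x, (|RCLike.re (f x) - g₁ x| + |RCLike.im (f x) - g₂ x|) ∂μ :=
          integral_mono (hf.sub hi).norm ((hf.re.sub hi₁).abs.add (hf.im.sub hi₂).abs) hle
      _ = ∫ x, |RCLike.re (f x) - g₁ x| ∂μ + ∫ x, |RCLike.im (f x) - g₂ x| ∂μ :=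
          integral_add (hf.re.sub hi₁).abs (hf.im.sub hi₂).abs
      _ < ε := by linarith

/-! ### Eigenfunctions are almost constant on the towers, up to the phase -/

theorem integrable_pow_addr_mul {lam : ℂ} (hlam : ‖lam‖ = 1) {f : B.Path → ℂ}
    (hf : Integrable f μ) (q : ℕ → ℕ) (m n : ℕ) :
    Integrable (fun x => lam ^ addr q m n x * f x) μ := by
  refine (integrable_norm_iff ?_).1 (by simpa [hlam] using hf.norm)
  exact ((measurable_of_countable fun k : ℕ => lam ^ k).comp
    (measurable_addr q m n)).aestronglyMeasurable.mul hf.aestronglyMeasurable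

theorem integrable_comp_tau [IsProbabilityMeasure μ] (n : ℕ) (c : B.V n → ℂ) :
    Integrable (fun x => c (B.tau n x)) μ := by
  have := Fintype.ofFinite (B.V n)
  have hc : Measurable fun x => c (B.tau n x) := measurable_of_cylinder (n + 1) fun x y h => by
    rw [tau, tau, h n n.lt_succ_self]
  refine Integrable.of_bound hc.aestronglyMeasurable (∑ t, ‖c t‖) (ae_of_all _ fun x => ?_)
  exact Finset.single_le_sum (f := fun t => ‖c t‖) (fun _ _ => norm_nonneg _) (Finset.mem_univ _)

variable {q : ℕ → ℕ} (hq : B.IsToeplitz q) (hB : B.IsProperlyOrdered) [IsProbabilityMeasure μ]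
include hq

/-- On level `k` of the tower `g` is a constant `γ k`. Since `lam ^ addr * f` is invariant inside
the tower, the error on that level is `1 / qProd q 0 n` times the integral over the whole tower of
the distance to `lam ^ k * γ k`. The right-hand side is thus an average over `k`, and the best `k`
does at least as well. -/
theorem IsToeplitz.exists_setIntegral_tau_le (hT : MeasurePreserving (B.vershik hB) μ μ)
    {lam : ℂ} (hlam : ‖lam‖ = 1) {f : B.Path → ℂ} (hf : Integrable f μ)
    (hfT : ∀ᵐ x ∂μ, f (B.vershik hB x) = lam * f x) {n : ℕ} {g : B.Path → ℂ}
    (hg : ∀ x y : B.Path, (∀ i < n, x.1 i = y.1 i) → g x = g y) (hgi : Integrable g μ)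
    (t : B.V n) :
    ∃ c : ℂ, ∫ x in {x | B.tau n x = t}, ‖lam ^ addr q 0 n x * f x - c‖ ∂μ ≤
      ∫ x in {x | B.tau n x = t}, ‖f x - g x‖ ∂μ := by
  have hpos : (0 : ℝ) < qProd q 0 n := Nat.cast_pos.2 (hq.qProd_pos 0 n)
  have hA := measurableSet_tau_eq n t
  have hS : ∀ k, MeasurableSet {x : B.Path | addr q 0 n x = k} := fun k =>
    measurable_addr q 0 n (measurableSet_singleton k)
  have hd : Integrable (fun x => ‖f x - g x‖) μ := (hf.sub hgi).norm
  have hex : ∀ k, ∃ c : ℂ, ∀ x : B.Path, B.tau n x = t → addr q 0 n x = k →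
      g x = c := by
    intro k
    by_cases h : ∃ y : B.Path, B.tau n y = t ∧ addr q 0 n y = k
    · obtain ⟨y, hy, hyk⟩ := h
      exact ⟨g y, fun x hx hxk => hg x y fun i hi => hq.eq_of_addr_eq (Nat.zero_le n)
        (hx.trans hy.symm) (hxk.trans hyk.symm) i (Nat.zero_le i) hi⟩
    · exact ⟨0, fun x hx hxk => absurd ⟨x, hx, hxk⟩ h⟩
  choose γ hγ using hex
  let ψ : ℂ → B.Path → ℝ := fun c =>
    {x | B.tau n x = t}.indicator fun x => ‖lam ^ addr q 0 n x * f x - c‖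
  have hψ : ∀ c, Integrable (ψ c) μ := fun c =>
    ((integrable_pow_addr_mul hlam hf q 0 n).sub (integrable_const c)).norm.indicator hA
  have hinv : ∀ c, ∀ᵐ x ∂μ, addr q 0 n x ≠ 0 → ψ c (B.vershik hB x) = ψ c x := by
    intro c
    filter_upwards [hfT] with x hx hx0
    obtain ⟨h1, h2⟩ := (hq.addr_vershik hB n x).resolve_right fun h => hx0 h.1
    have hiff : B.vershik hB x ∈ {x | B.tau n x = t} ↔ x ∈ {x | B.tau n x = t} := by
      rw [Set.mem_ofPred_eq, h2, Set.mem_ofPred_eq]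
    by_cases ht : x ∈ {x | B.tau n x = t}
    · simp only [ψ]
      rw [Set.indicator_of_mem (hiff.2 ht), Set.indicator_of_mem ht, hx, h1, pow_succ, mul_assoc]
    · simp only [ψ]
      rw [Set.indicator_of_notMem (hiff.not.2 ht), Set.indicator_of_notMem ht]
  have hsum : ∫ x in {x | B.tau n x = t}, ‖f x - g x‖ ∂μ =
      ∑ k ∈ Finset.range (qProd q 0 n), (qProd q 0 n : ℝ)⁻¹ * ∫ x, ψ (lam ^ k * γ k) x ∂μ := by
    rw [← integral_indicator hA, integral_eq_sum_setIntegral_fiber (g := addr q 0 n)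
      (Finset.range (qProd q 0 n)) (fun i _ => hS i)
      (fun x => Finset.mem_range.2 (hq.addr_lt (Nat.zero_le n) x))
      (hd.indicator hA)]
    refine Finset.sum_congr rfl fun k hk => ?_
    rw [← hq.setIntegral_addr_eq hB hT n (hψ _) (hinv _) (Finset.mem_range.1 hk), smul_eq_mul,
      inv_mul_cancel_left₀ hpos.ne']
    refine setIntegral_congr_fun (hS k) fun x hx => ?_
    by_cases ht : x ∈ {x | B.tau n x = t}
    · have hxk : addr q 0 n x = k := hx
      simp only [ψ]
      rw [Set.indicator_of_mem ht, Set.indicator_of_mem ht, hγ k x ht hxk, hxk, ← mul_sub,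
        norm_mul, norm_pow, hlam, one_pow, one_mul]
    · simp only [ψ]
      rw [Set.indicator_of_notMem ht, Set.indicator_of_notMem ht]
  obtain ⟨k, -, hk⟩ := (Finset.range (qProd q 0 n)).exists_min_image
    (fun k => ∫ x, ψ (lam ^ k * γ k) x ∂μ) ⟨0, Finset.mem_range.2 (hq.qProd_pos 0 n)⟩
  refine ⟨lam ^ k * γ k, ?_⟩
  rw [hsum, ← Finset.mul_sum, ← integral_indicator hA, inv_mul_eq_div, le_div_iff₀ hpos, mul_comm]
  simpa using Finset.card_nsmul_le_sum _ _ _ hk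

theorem IsToeplitz.exists_integral_sub_comp_tau_le (hT : MeasurePreserving (B.vershik hB) μ μ)
    {lam : ℂ} (hlam : ‖lam‖ = 1) {f : B.Path → ℂ} (hf : Integrable f μ)
    (hf1 : ∀ᵐ x ∂μ, ‖f x‖ = 1)
    (hfT : ∀ᵐ x ∂μ, f (B.vershik hB x) = lam * f x) {ε : ℝ} (hε : 0 < ε) :
    ∃ N, ∀ n ≥ N, ∃ c : B.V n → ℂ, (∀ t, ‖c t‖ = 1) ∧
      ∫ x, ‖lam ^ addr q 0 n x * f x - c (B.tau n x)‖ ∂μ ≤ ε := by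
  obtain ⟨N, g, hg, hgi, hfg⟩ := exists_cylinder_integral_norm_sub_lt hf (half_pos hε)
  refine ⟨N, fun n hn => ?_⟩
  have := Fintype.ofFinite (B.V n)
  choose c hc using hq.exists_setIntegral_tau_le hB hT hlam hf hfT
    fun x y h => hg x y fun i hi => h i (hi.trans_le hn)
  specialize hc hgi
  have hd : Integrable (fun x => ‖f x - g x‖) μ := (hf.sub hgi).norm
  have hI : ∀ c : B.V n → ℂ,
      Integrable (fun x => ‖lam ^ addr q 0 n x * f x - c (B.tau n x)‖) μ := fun c =>
    ((integrable_pow_addr_mul hlam hf q 0 n).sub (integrable_comp_tau n c)).norm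
  have hle : ∫ x, ‖lam ^ addr q 0 n x * f x - c hgi (B.tau n x)‖ ∂μ ≤ ε / 2 := by
    refine le_trans ?_ hfg.le
    rw [integral_eq_sum_setIntegral_fiber (g := B.tau n) Finset.univ
      (fun t _ => measurableSet_tau_eq n t) (fun _ => Finset.mem_univ _) (hI _),
      integral_eq_sum_setIntegral_fiber (g := B.tau n) Finset.univ
      (fun t _ => measurableSet_tau_eq n t) (fun _ => Finset.mem_univ _) hd]
    refine Finset.sum_le_sum fun t _ => le_trans (le_of_eq ?_) (hc t)
    refine setIntegral_congr_fun (measurableSet_tau_eq n t) fun x hx => ?_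
    have : B.tau n x = t := hx
    simp only [this]
  -- Normalising `w` moves it by no more than its distance to any unimodular `z`, so unimodular
  -- constants cost a factor 2. This is why the cylinder approximation was taken within `ε / 2`.
  have hround : ∀ w : ℂ, ∃ e : ℂ, ‖e‖ = 1 ∧ ∀ z : ℂ, ‖z‖ = 1 → ‖z - e‖ ≤ 2 * ‖z - w‖ := by
    intro w
    by_cases hw : w = 0
    · refine ⟨1, norm_one, fun z hz => (norm_sub_le _ _).trans ?_⟩
      rw [hw, sub_zero, hz, norm_one]
      norm_num
    · have hw' : ‖w‖ ≠ 0 := norm_ne_zero_iff.2 hw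
      have hw'' : (‖w‖ : ℂ) ≠ 0 := Complex.ofReal_ne_zero.2 hw'
      refine ⟨w / ‖w‖, by simp [hw'], fun z hz => ?_⟩
      have h1 : w - w / ‖w‖ = (w / ‖w‖) * ((‖w‖ - 1 : ℝ) : ℂ) := by
        push_cast
        field_simp
      have h2 : ‖w - w / ‖w‖‖ ≤ ‖z - w‖ := by
        rw [h1, norm_mul, norm_div, Complex.norm_real, Complex.norm_real, norm_norm,
          div_self hw', one_mul, Real.norm_eq_abs, ← hz, norm_sub_rev z w]
        exact abs_norm_sub_norm_le w z
      calc ‖z - w / ‖w‖‖ ≤ ‖z - w‖ + ‖w - w / ‖w‖‖ := norm_sub_le_norm_sub_add_norm_sub _ _ _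
        _ ≤ 2 * ‖z - w‖ := by linarith
  choose e he1 he using hround
  refine ⟨fun t => e (c hgi t), fun t => he1 _, ?_⟩
  calc ∫ x, ‖lam ^ addr q 0 n x * f x - e (c hgi (B.tau n x))‖ ∂μ
      ≤ ∫ x, 2 * ‖lam ^ addr q 0 n x * f x - c hgi (B.tau n x)‖ ∂μ := by
        refine integral_mono_ae (hI fun t => e (c hgi t)) ((hI _).const_mul 2) ?_
        filter_upwards [hf1] with x hx
        exact he _ _ (by simp [hlam, hx])
    _ ≤ ε := by
        rw [integral_const_mul]
        linarith

end OrderedBratteliDiagram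

/-! ### Necessity of the two conditions. -/

theorem Nat.exists_eventually_eq_of_monotone_of_le {g : ℕ → ℕ} (hg : Monotone g) {b : ℕ}
    (hb : ∀ n, g n ≤ b) : ∃ n₀, ∀ n ≥ n₀, g n = g n₀ := by
  have hbdd : BddAbove (Set.range g) := ⟨b, by rintro _ ⟨n, rfl⟩; exact hb n⟩
  obtain ⟨n₀, h₀⟩ := Nat.sSup_mem (Set.range_nonempty g) hbdd
  exact ⟨n₀, fun n hn => le_antisymm (h₀ ▸ le_csSup hbdd ⟨n, rfl⟩) (hg hn)⟩

theorem ae_iterate_eq_pow_mul {X : Type*} [MeasurableSpace X] {μ : Measure X} {T : X → X}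
    (hT : MeasurePreserving T μ μ) {lam : ℂ} {f : X → ℂ} (hf : ∀ᵐ x ∂μ, f (T x) = lam * f x)
    (k : ℕ) : ∀ᵐ x ∂μ, f (T^[k] x) = lam ^ k * f x := by
  induction k with
  | zero => simp
  | succ k ih =>
    filter_upwards [ih, (hT.iterate k).quasiMeasurePreserving.ae hf] with x h1 h2
    rw [Function.iterate_succ_apply', h2, h1, pow_succ]
    ring

/-- An eigenfunction of an ergodic map for a root of unity can be chosen with values in the roots
of unity. -/
theorem exists_eigenfunction_pow_eq_one {X : Type*} [MeasurableSpace X] {μ : Measure X}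
    {T : X → X} (hT : Ergodic T μ) {lam : ℂ} {b : ℕ} (hb : 0 < b)
    (hlam : lam ^ b = 1) (h : IsMeasurableEigenvalue T μ lam) :
    ∃ f : X → ℂ, Measurable f ∧ (∀ x, f x ^ b = 1) ∧ ∀ᵐ x ∂μ, f (T x) = lam * f x := by
  obtain ⟨f, hf, hf0, hfT⟩ := h
  -- Since `lam ^ b = 1`, the power `f ^ b` is invariant, hence constant by ergodicity. Dividing `f`
  -- by a `b`-th root of this constant and correcting on a null set gives the required function.
  obtain ⟨c, hc⟩ := hT.ae_eq_const_of_ae_eq_comp_ae (g := fun x => f x ^ b)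
    (hf.aestronglyMeasurable.pow b) (by
      filter_upwards [hfT] with x hx
      simp [hx, mul_pow, hlam])
  have hc0 : c ≠ 0 := by
    rintro rfl
    refine hf0 ?_
    filter_upwards [hc] with x hx
    exact pow_eq_zero_iff hb.ne' |>.1 hx
  obtain ⟨ρ, hρ⟩ := IsAlgClosed.exists_pow_nat_eq c hb
  have hρ0 : ρ ≠ 0 := by
    rintro rfl
    exact hc0 (by rw [← hρ, zero_pow hb.ne'])
  obtain ⟨f', hf', hff'⟩ := hf.aestronglyMeasurable
  have hm : Measurable fun x => f' x / ρ := hf'.measurable.div_const ρ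
  let S : Set X := {x | (f' x / ρ) ^ b = 1}
  have hS : MeasurableSet S := (hm.pow_const b) (measurableSet_singleton 1)
  classical
  have hg : (S.piecewise (fun x => f' x / ρ) fun _ => 1) =ᵐ[μ] fun x => f x / ρ := by
    filter_upwards [hff', hc] with x hx hcx
    have : x ∈ S := by
      simp only [S, Set.mem_ofPred_eq]
      rw [← hx, div_pow, hρ]
      exact (congrArg (· / c) hcx).trans (div_self hc0)
    rw [Set.piecewise_eq_of_mem _ _ _ this, hx]
  refine ⟨S.piecewise (fun x => f' x / ρ) fun _ => 1, hm.piecewise hS measurable_const,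
    fun x => ?_, ?_⟩
  · by_cases hx : x ∈ S
    · rw [Set.piecewise_eq_of_mem _ _ _ hx]; exact hx
    · rw [Set.piecewise_eq_of_notMem _ _ _ hx, one_pow]
  · filter_upwards [hg, hT.quasiMeasurePreserving.ae hg, hfT] with x h1 h2 h3
    rw [h1, h2, h3, mul_div_assoc]

namespace OrderedBratteliDiagram

variable {B : OrderedBratteliDiagram} {μ : Measure B.Path} {q : ℕ → ℕ} (hq : B.IsToeplitz q)
  (hB : B.IsProperlyOrdered) [IsProbabilityMeasure μ]

theorem integral_eq_sum_label {d : ℕ} {label : ∀ n, Fin d → B.V n} (hlabel : B.IsProper label)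
    {n : ℕ} (hn : 1 ≤ n) {F : Type*} [NormedAddCommGroup F] [NormedSpace ℝ F]
    {ν : Measure B.Path} {ψ : B.Path → F} (hψ : Integrable ψ ν) :
    ∫ x, ψ x ∂ν = ∑ t, ∫ x in {x | B.tau n x = label n t}, ψ x ∂ν := by
  let e := Equiv.ofBijective _ (hlabel.rank n hn)
  have he : ∀ t, {x | e.symm (B.tau n x) = t} = {x | B.tau n x = label n t} := fun t => by
    ext x
    exact Equiv.symm_apply_eq e
  rw [integral_eq_sum_setIntegral_fiber (g := fun x => e.symm (B.tau n x)) Finset.univ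
    (fun t _ => by rw [he]; exact measurableSet_tau_eq n _) (fun _ => Finset.mem_univ _) hψ]
  exact Finset.sum_congr rfl fun t _ => by rw [he]

include hq

theorem IsToeplitz.exists_orderOf_le_card (hT : MeasurePreserving (B.vershik hB) μ μ)
    {lam : ℂ} {b : ℕ} (hb : 0 < b) (hlam : lam ^ b = 1) {f : B.Path → ℂ} (hf : Measurable f)
    (hf1 : ∀ x, f x ^ b = 1) (hfT : ∀ᵐ x ∂μ, f (B.vershik hB x) = lam * f x) :
    ∃ N, ∀ m ≥ N, orderOf (lam ^ qProd q 0 m) ≤ Nat.card (B.V m) := by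
  have hb' : (0 : ℝ) < b := Nat.cast_pos.2 hb
  have hl1 : ‖lam‖ = 1 := Complex.norm_eq_one_of_pow_eq_one hlam hb.ne'
  have hl0 : lam ≠ 0 := norm_ne_zero_iff.1 (by rw [hl1]; exact one_ne_zero)
  have hfn : ∀ x, ‖f x‖ = 1 := fun x => Complex.norm_eq_one_of_pow_eq_one (hf1 x) hb.ne'
  have hfi : Integrable f μ :=
    Integrable.of_bound hf.aestronglyMeasurable 1 (ae_of_all _ fun x => (hfn x).le)
  obtain ⟨κ, hκ, hsep⟩ := exists_separation_of_pow_eq_one hb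
  obtain ⟨N, hN⟩ := hq.exists_integral_sub_comp_tau_le hB hT hl1 hfi (ae_of_all _ hfn) hfT
    (ε := κ / (4 * b)) (by positivity)
  refine ⟨N, fun m hm => ?_⟩
  obtain ⟨c, -, hc⟩ := hN m hm
  set ω := lam ^ qProd q 0 m with hω
  have hωb : ω ^ b = 1 := by rw [hω, ← pow_mul, mul_comm, pow_mul, hlam, one_pow]
  have hω0 : ω ≠ 0 := pow_ne_zero _ hl0
  let h : B.Path → ℂ := fun x => lam ^ addr q 0 m x * f x
  have hh : Measurable h := ((measurable_of_countable fun k : ℕ => lam ^ k).comp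
    (measurable_addr q 0 m)).mul hf
  have hh1 : ∀ x, h x ^ b = 1 := fun x => by
    rw [mul_pow, ← pow_mul, mul_comm _ b, pow_mul, hlam, one_pow, hf1, one_mul]
  have hS : ∀ v, MeasurableSet {x | h x = v} := fun v => hh (measurableSet_singleton v)
  -- Iterating `qProd q 0 m` times keeps the height and multiplies `f` by `ω`.
  have hrot : ∀ v, μ.real {x | h x = ω * v} = μ.real {x | h x = v} := by
    intro v
    rw [← (hT.iterate (qProd q 0 m)).measureReal_preimage (hS _).nullMeasurableSet]
    refine measureReal_congr ?_
    filter_upwards [ae_iterate_eq_pow_mul hT hfT (qProd q 0 m)] with x hx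
    refine propext ?_
    change h _ = ω * v ↔ h x = v
    simp only [h, hq.addr_iterate_qProd hB, hx]
    rw [← hω, mul_left_comm, mul_right_inj' hω0]
  have hrot' : ∀ (j : ℕ) v, μ.real {x | h x = ω ^ j * v} = μ.real {x | h x = v} := by
    intro j v
    induction j with
    | zero => simp
    | succ j ih => rw [pow_succ', mul_assoc, hrot, ih]
  -- One of the `b` possible values of `h` carries at least the average mass.
  obtain ⟨v, hvb, hv⟩ : ∃ v : ℂ, v ^ b = 1 ∧ (b : ℝ)⁻¹ ≤ μ.real {x | h x = v} := by
    by_contra! hcon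
    have h1 := integral_eq_sum_setIntegral_fiber (μ := μ) (g := h)
      (Polynomial.nthRootsFinset b (1 : ℂ)) (fun v _ => hS v)
      (fun x => (Polynomial.mem_nthRootsFinset hb _).2 (hh1 x)) (integrable_const (1 : ℝ))
    simp only [integral_const, measureReal_restrict_apply_univ, smul_eq_mul, mul_one,
      probReal_univ] at h1
    have hcard : (Polynomial.nthRootsFinset b (1 : ℂ)).card = b :=
      (Complex.isPrimitiveRoot_exp b hb.ne').card_nthRootsFinset
    have h2 := Finset.sum_lt_sum_of_nonempty (s := Polynomial.nthRootsFinset b (1 : ℂ))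
      (Finset.card_pos.1 (by rw [hcard]; exact hb))
      fun v hv => hcon v ((Polynomial.mem_nthRootsFinset hb _).1 hv)
    rw [← h1, Finset.sum_const, hcard, nsmul_eq_mul, mul_inv_cancel₀ hb'.ne'] at h2
    exact lt_irrefl _ h2
  have hv0 : v ≠ 0 := by rintro rfl; simp [hb.ne'] at hvb
  by_contra! hlt
  -- Pigeonhole: with more rotated values than vertices, if each were within `κ / 2` of some `c t`,
  -- two of them would share the same `t` and be closer than `κ`. The isolated value has mass at
  -- least `1 / b`, giving an error of at least `κ / (2b)`, above the allowed `κ / (4b)`.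
  obtain ⟨j, hj⟩ : ∃ j : ℕ, ∀ t, κ / 2 ≤ ‖ω ^ j * v - c t‖ := by
    by_contra! hcon
    choose t ht using hcon
    have hinj : Function.Injective fun j : Fin (orderOf ω) => t j := by
      intro i j hij
      have hij' : t i = t j := hij
      have hroot : ∀ j : ℕ, (ω ^ j * v) ^ b = 1 := fun j => by
        rw [mul_pow, hvb, ← pow_mul, mul_comm j, pow_mul, hωb, one_pow, one_mul]
      have h1 : ω ^ (i : ℕ) * v = ω ^ (j : ℕ) * v := by
        refine hsep _ _ (hroot i) (hroot j) ?_
        have h2 := ht i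
        have h3 := ht j
        rw [hij'] at h2
        rw [norm_sub_rev] at h3
        calc _ ≤ _ := norm_sub_le_norm_sub_add_norm_sub _ (c (t j)) _
          _ < κ := by linarith
      exact Fin.ext (pow_injOn_Iio_orderOf i.2 j.2 (mul_right_cancel₀ hv0 h1))
    have := Nat.card_le_card_of_injective _ hinj
    rw [Nat.card_eq_fintype_card, Fintype.card_fin] at this
    omega
  have hint : Integrable (fun x => ‖h x - c (B.tau m x)‖) μ :=
    ((integrable_pow_addr_mul hl1 hfi q 0 m).sub (integrable_comp_tau m c)).norm
  have h1 : κ / 2 * μ.real {x | h x = ω ^ j * v} ≤ κ / (4 * b) := by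
    refine le_trans ?_ ((setIntegral_le_integral (s := {x | h x = ω ^ j * v}) hint
      (ae_of_all _ fun _ => norm_nonneg _)).trans hc)
    rw [mul_comm, ← smul_eq_mul, ← setIntegral_const]
    refine setIntegral_mono_on (integrable_const _).integrableOn hint.integrableOn (hS _)
      fun x hx => ?_
    rw [show h x = ω ^ j * v from hx]
    exact hj _
  rw [hrot'] at h1
  have h2 := (mul_le_mul_of_nonneg_left hv (half_pos hκ).le).trans h1
  rw [div_mul_eq_mul_div, ← div_eq_mul_inv, div_div, div_le_div_iff₀ (by positivity)
    (by positivity)] at h2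
  nlinarith [mul_pos hκ hb']

theorem IsToeplitz.abs_sum_suffix_sub_one_lt (hT : MeasurePreserving (B.vershik hB) μ μ)
    {d : ℕ} {label : ∀ n, Fin d → B.V n} (hproper : B.IsProper label) (I : Finset (Fin d))
    {δ : ℝ} (hδ : 0 < δ) (hI : ∀ t ∈ I, ∀ n ≥ 1, δ ≤ μ.real {x | B.tau n x = label n t})
    (hI' : ∀ t ∉ I, Tendsto (fun n => μ.real {x | B.tau n x = label n t}) atTop (𝓝 0))
    {lam : ℂ} (hlam : ‖lam‖ = 1) {f : B.Path → ℂ} (hf : Measurable f) (hf1 : ∀ x, ‖f x‖ = 1)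
    (hfT : ∀ᵐ x ∂μ, f (B.vershik hB x) = lam * f x) {t₂ : Fin d} (ht₂ : t₂ ∈ I) {ε : ℝ}
    (hε : 0 < ε) :
    ∃ N : ℕ, ∀ m n : ℕ, N ≤ m → m < n →
      |(∑ t₁ ∈ I, ‖∑ s ∈ B.suffixFinset m n (label m t₁) (label n t₂),
        lam ^ (-((qProd q 0 m : ℤ) * (s : ℤ)))‖ / (qProd q m n : ℝ)) - 1| < ε := by
  classical
  have hl0 : lam ≠ 0 := norm_ne_zero_iff.1 (by rw [hlam]; exact one_ne_zero)
  have hfi : Integrable f μ :=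
    Integrable.of_bound hf.aestronglyMeasurable 1 (ae_of_all _ fun x => (hf1 x).le)
  -- The loss is `2η` from the approximations at levels `m` and `n`, and at most `dη` from vertices
  -- outside `I`. Division by a tower mass of at least `δ` leaves `ε / 2`.
  let η : ℝ := ε * δ / (2 * (d + 2))
  have hη : 0 < η := by positivity
  obtain ⟨N₁, hN₁⟩ := hq.exists_integral_sub_comp_tau_le hB hT hlam hfi (ae_of_all _ hf1) hfT hη
  have hN₂ : ∀ᶠ n in atTop, ∀ t ∉ I, μ.real {x | B.tau n x = label n t} < η := by
    rw [eventually_all]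
    intro t
    by_cases ht : t ∈ I
    · exact Eventually.of_forall fun n h => absurd ht h
    · filter_upwards [(tendsto_order.1 (hI' t ht)).2 η hη] with n hn _ using hn
  obtain ⟨N₂, hN₂⟩ := eventually_atTop.1 hN₂
  refine ⟨max 1 (max N₁ N₂), fun m n hm hmn => ?_⟩
  have hm1 : 1 ≤ m := (le_max_left _ _).trans hm
  have hm2 : N₁ ≤ m := (le_max_left _ _).trans ((le_max_right _ _).trans hm)
  have hm3 : N₂ ≤ m := (le_max_right _ _).trans ((le_max_right _ _).trans hm)
  obtain ⟨c, hc1, hc⟩ := hN₁ m hm2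
  obtain ⟨e, he1, he⟩ := hN₁ n (hm2.trans hmn.le)
  let S₁ : Fin d → Set B.Path := fun t => {x | B.tau m x = label m t}
  let S₂ : Set B.Path := {x | B.tau n x = label n t₂}
  have hS₁ : ∀ t, MeasurableSet (S₁ t) := fun t => measurableSet_tau_eq m _
  have hS₂ : MeasurableSet S₂ := measurableSet_tau_eq n _
  have hμ₂ : δ ≤ μ.real S₂ := hI t₂ ht₂ n (by omega)
  let E : B.Path → ℝ := fun x => ‖lam ^ addr q 0 m x * f x - c (B.tau m x)‖ +
    ‖lam ^ addr q 0 n x * f x - e (B.tau n x)‖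
  have hEm : Integrable (fun x => ‖lam ^ addr q 0 m x * f x - c (B.tau m x)‖) μ :=
    ((integrable_pow_addr_mul hlam hfi q 0 m).sub (integrable_comp_tau m c)).norm
  have hEn : Integrable (fun x => ‖lam ^ addr q 0 n x * f x - e (B.tau n x)‖) μ :=
    ((integrable_pow_addr_mul hlam hfi q 0 n).sub (integrable_comp_tau n e)).norm
  have hEi : Integrable E μ := hEm.add hEn
  have hE0 : ∀ x, 0 ≤ E x := fun x => add_nonneg (norm_nonneg _) (norm_nonneg _)
  have hE : ∫ x, E x ∂μ ≤ 2 * η := by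
    rw [integral_add hEm hEn]
    linarith
  let w : B.Path → ℂ := fun x => lam ^ (-((qProd q 0 m : ℤ) * (addr q m n x : ℤ)))
  have hw1 : ∀ x, ‖w x‖ = 1 := fun x => by simp [w, hlam]
  have hwi : Integrable w μ := Integrable.of_bound
    ((measurable_of_countable fun k : ℕ => lam ^ (-((qProd q 0 m : ℤ) * (k : ℤ)))).comp
      (measurable_addr q m n)).aestronglyMeasurable 1 (ae_of_all _ fun x => (hw1 x).le)
  -- As `f` is unimodular it cancels between the phase at level `m` and the conjugate phase at level
  -- `n`, leaving exactly `w`.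
  have hwE : ∀ x, ‖w x - c (B.tau m x) * (starRingEnd ℂ) (e (B.tau n x))‖ ≤ E x := by
    intro x
    have h1 : w x = (lam ^ addr q 0 m x * f x) *
        (starRingEnd ℂ) (lam ^ addr q 0 n x * f x) := by
      rw [← Complex.inv_eq_conj (by simp [hlam, hf1]), addr_add q (Nat.zero_le m) hmn.le x]
      have hfx : f x ≠ 0 := norm_ne_zero_iff.1 (by rw [hf1]; exact one_ne_zero)
      simp only [w]
      rw [zpow_neg, ← Nat.cast_mul, zpow_natCast, pow_add]
      field_simp
    rw [h1]
    have hA : ‖lam ^ addr q 0 m x * f x‖ = 1 := by simp [hlam, hf1]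
    simp only [E]
    generalize lam ^ addr q 0 n x * f x = Z
    generalize lam ^ addr q 0 m x * f x = A at hA ⊢
    calc ‖A * (starRingEnd ℂ) Z - c (B.tau m x) * (starRingEnd ℂ) (e (B.tau n x))‖
        = ‖(A - c (B.tau m x)) * (starRingEnd ℂ) (e (B.tau n x)) +
            A * (starRingEnd ℂ) (Z - e (B.tau n x))‖ := by
          rw [map_sub]
          congr 1
          ring
      _ ≤ ‖A - c (B.tau m x)‖ + ‖Z - e (B.tau n x)‖ := by
          refine (norm_add_le _ _).trans_eq ?_
          rw [norm_mul, norm_mul, RCLike.norm_conj, RCLike.norm_conj, he1, hA, mul_one, one_mul]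
  have hterm : ∀ t, μ.real S₂ * (‖∑ s ∈ B.suffixFinset m n (label m t) (label n t₂),
      lam ^ (-((qProd q 0 m : ℤ) * (s : ℤ)))‖ / (qProd q m n : ℝ)) =
      ‖∫ x in S₁ t ∩ S₂, w x ∂μ‖ := by
    intro t
    have h := hq.setIntegral_tau_tau_comp_addr hB hT hmn (label m t) (label n t₂)
      fun s => lam ^ (-((qProd q 0 m : ℤ) * (s : ℤ)))
    rw [h, norm_mul, Complex.norm_real, Real.norm_of_nonneg (by positivity)]
    ring
  have hupper : ∀ t, ‖∫ x in S₁ t ∩ S₂, w x ∂μ‖ ≤ μ.real (S₁ t ∩ S₂) := by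
    intro t
    simpa using norm_setIntegral_le_of_norm_le_const (measure_lt_top μ (S₁ t ∩ S₂))
      fun x _ => (hw1 x).le
  -- On this intersection the approximation of `w` is a single unimodular constant `a`, whose
  -- integral has modulus equal to the measure.
  have hlower : ∀ t, μ.real (S₁ t ∩ S₂) - ∫ x in S₁ t ∩ S₂, E x ∂μ ≤
      ‖∫ x in S₁ t ∩ S₂, w x ∂μ‖ := by
    intro t
    let a : ℂ := c (label m t) * (starRingEnd ℂ) (e (label n t₂))
    have ha : ‖a‖ = 1 := by simp [a, hc1, he1]
    have h1 : ‖∫ x in S₁ t ∩ S₂, (w x - a) ∂μ‖ ≤ ∫ x in S₁ t ∩ S₂, E x ∂μ := by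
      refine (norm_integral_le_integral_norm _).trans (setIntegral_mono_on
        (hwi.sub (integrable_const a)).norm.integrableOn hEi.integrableOn
        ((hS₁ t).inter hS₂) fun x hx => ?_)
      have h := hwE x
      rwa [show B.tau m x = label m t from hx.1, show B.tau n x = label n t₂ from hx.2] at h
    rw [integral_sub hwi.integrableOn (integrable_const a), setIntegral_const] at h1
    have h2 : ‖μ.real (S₁ t ∩ S₂) • a‖ = μ.real (S₁ t ∩ S₂) := by
      rw [norm_smul, ha, mul_one, Real.norm_of_nonneg measureReal_nonneg]
    have h3 := norm_sub_norm_le (μ.real (S₁ t ∩ S₂) • a) (∫ x in S₁ t ∩ S₂, w x ∂μ)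
    rw [norm_sub_rev, h2] at h3
    linarith
  have hsplit : ∀ ψ : B.Path → ℝ, Integrable ψ μ →
      ∑ t, ∫ x in S₁ t ∩ S₂, ψ x ∂μ = ∫ x in S₂, ψ x ∂μ := by
    intro ψ hψ
    rw [integral_eq_sum_label hproper hm1 hψ.integrableOn]
    exact Finset.sum_congr rfl fun t _ => by rw [Measure.restrict_restrict (hS₁ t)]
  have hmass : ∑ t, μ.real (S₁ t ∩ S₂) = μ.real S₂ := by
    simpa using hsplit (fun _ => 1) (integrable_const _)
  have hEsum : ∑ t ∈ I, ∫ x in S₁ t ∩ S₂, E x ∂μ ≤ 2 * η := by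
    calc ∑ t ∈ I, ∫ x in S₁ t ∩ S₂, E x ∂μ ≤ ∑ t, ∫ x in S₁ t ∩ S₂, E x ∂μ :=
          Finset.sum_le_univ_sum_of_nonneg fun t => integral_nonneg hE0
      _ = ∫ x in S₂, E x ∂μ := hsplit E hEi
      _ ≤ ∫ x, E x ∂μ := setIntegral_le_integral hEi (ae_of_all _ hE0)
      _ ≤ 2 * η := hE
  have hmassI : ∑ t ∈ I, μ.real (S₁ t ∩ S₂) ≤ μ.real S₂ :=
    hmass ▸ Finset.sum_le_univ_sum_of_nonneg fun t => measureReal_nonneg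
  have hmassI' : μ.real S₂ - d * η ≤ ∑ t ∈ I, μ.real (S₁ t ∩ S₂) := by
    rw [← hmass, ← Finset.sum_add_sum_compl I]
    have h1 : ∑ t ∈ Iᶜ, μ.real (S₁ t ∩ S₂) ≤ ∑ t ∈ Iᶜ, η :=
      Finset.sum_le_sum fun t ht => (measureReal_mono Set.inter_subset_left).trans
        (hN₂ m hm3 t (Finset.mem_compl.1 ht)).le
    have h2 : ∑ t ∈ Iᶜ, η ≤ d * η := by
      rw [Finset.sum_const, nsmul_eq_mul]
      gcongr
      simpa using Finset.card_le_univ Iᶜ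
    linarith
  set u := ∑ t₁ ∈ I, ‖∑ s ∈ B.suffixFinset m n (label m t₁) (label n t₂),
        lam ^ (-((qProd q 0 m : ℤ) * (s : ℤ)))‖ / (qProd q m n : ℝ) with hu
  have hu' : μ.real S₂ * u = ∑ t ∈ I, ‖∫ x in S₁ t ∩ S₂, w x ∂μ‖ := by
    rw [hu, Finset.mul_sum]
    exact Finset.sum_congr rfl fun t _ => hterm t
  have hpos : 0 < μ.real S₂ := hδ.trans_le hμ₂
  have h1 : μ.real S₂ * u ≤ μ.real S₂ :=
    hu' ▸ (Finset.sum_le_sum fun t _ => hupper t).trans hmassI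
  have h2 : μ.real S₂ - (d + 2) * η ≤ μ.real S₂ * u := by
    have h := Finset.sum_le_sum (s := I) fun t _ => hlower t
    rw [Finset.sum_sub_distrib, ← hu'] at h
    linarith
  have h3 : (d + 2) * η = ε * δ / 2 := by
    simp only [η]
    field_simp
  have h4 : u ≤ 1 := le_of_mul_le_mul_left (by linarith) hpos
  rw [abs_sub_comm, abs_of_nonneg (by linarith)]
  have h5 : μ.real S₂ * (1 - u) ≤ μ.real S₂ * (ε / 2) := by
    have : ε * δ / 2 ≤ μ.real S₂ * (ε / 2) := by nlinarith
    linarith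
  have := le_of_mul_le_mul_left h5 hpos
  linarith

end OrderedBratteliDiagram

/-! ### Sufficiency: weak limits of approximate eigenfunctions. -/

/-- By Banach–Alaoglu the bounded sequence has a weak limit `v` along an ultrafilter. The equation
passes to the limit by moving `U` to its adjoint. Weak limits may vanish, but the lower bound on
finitely many pairings survives and excludes `v = 0`. -/
theorem exists_eigenvector_of_tendsto {H : Type*} [NormedAddCommGroup H] [InnerProductSpace ℂ H]
    [CompleteSpace H] (U : H →L[ℂ] H) (lam : ℂ) {F : ℕ → H} {C : ℝ} (hF : ∀ n, ‖F n‖ ≤ C)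
    (hU : Tendsto (fun n => U (F n) - lam • F n) atTop (𝓝 0)) {ι : Type*} (s : Finset ι)
    (g : ι → H) {c : ℝ} (hc : 0 < c) (hg : ∀ᶠ n in atTop, c ≤ ∑ i ∈ s, ‖inner ℂ (F n) (g i)‖) :
    ∃ v : H, v ≠ 0 ∧ U v = lam • v := by
  let 𝒰 : Ultrafilter ℕ := Ultrafilter.of atTop
  have h𝒰 : (𝒰 : Filter ℕ) ≤ atTop := Ultrafilter.of_le atTop
  let Φ : ℕ → WeakDual ℂ H := fun n => StrongDual.toWeakDual (InnerProductSpace.toDual ℂ H (F n))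
  obtain ⟨x, -, hx⟩ := (WeakDual.isCompact_closedBall (𝕜 := ℂ) (E := H) 0 C).ultrafilter_le_nhds'
    (𝒰.map Φ) (Ultrafilter.mem_map.2 (Eventually.of_forall fun n => by
      simpa [Φ] using hF n))
  let v : H := (InnerProductSpace.toDual ℂ H).symm (WeakDual.toStrongDual x)
  have hv : ∀ y, Tendsto (fun n => inner ℂ (F n) y) 𝒰 (𝓝 (inner ℂ v y)) := by
    intro y
    have h1 : Tendsto (fun n => Φ n y) 𝒰 (𝓝 (x y)) :=
      ((WeakDual.eval_continuous y).tendsto x).comp hx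
    have h2 : inner ℂ v y = x y := by
      rw [InnerProductSpace.toDual_symm_apply]
      rfl
    rw [h2]
    exact h1
  refine ⟨v, fun h0 => ?_, ?_⟩
  · have h1 : Tendsto (fun n => ∑ i ∈ s, ‖inner ℂ (F n) (g i)‖) 𝒰
        (𝓝 (∑ i ∈ s, ‖inner ℂ v (g i)‖)) := tendsto_finsetSum _ fun i _ => (hv (g i)).norm
    have h2 := ge_of_tendsto h1 (h𝒰 hg)
    simp only [h0, inner_zero_left, norm_zero, Finset.sum_const_zero] at h2
    exact h2.not_gt hc
  · refine ext_inner_right ℂ fun y => ?_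
    have h1 : Tendsto (fun n => inner ℂ (U (F n) - lam • F n) y) 𝒰
        (𝓝 (inner ℂ (U v) y - inner ℂ (lam • v) y)) := by
      simp only [inner_sub_left, inner_smul_left, ← ContinuousLinearMap.adjoint_inner_right]
      exact (hv _).sub ((hv y).const_mul _)
    have h2 : Tendsto (fun n => inner ℂ (U (F n) - lam • F n) y) 𝒰 (𝓝 0) := by
      have := (hU.mono_left h𝒰).inner (𝕜 := ℂ) (tendsto_const_nhds (x := y))
      rwa [inner_zero_left] at this
    exact sub_eq_zero.1 (tendsto_nhds_unique h1 h2)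

theorem norm_toLp_two_sq {X : Type*} [MeasurableSpace X] {μ : Measure X} {f : X → ℂ}
    (hf : MemLp f 2 μ) : ‖hf.toLp f‖ ^ 2 = ∫ x, ‖f x‖ ^ 2 ∂μ := by
  have h : (inner ℂ (hf.toLp f) (hf.toLp f) : ℂ) = ((∫ x, ‖f x‖ ^ 2 ∂μ : ℝ) : ℂ) := by
    rw [L2.inner_def, ← integral_complex_ofReal]
    refine integral_congr_ae ?_
    filter_upwards [hf.coeFn_toLp] with x hx
    rw [hx, inner_self_eq_norm_sq_to_K]
    simp
  rw [inner_self_eq_norm_sq_to_K, RCLike.ofReal_eq_complex_ofReal, ← Complex.ofReal_pow] at h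
  exact Complex.ofReal_injective h

namespace OrderedBratteliDiagram

variable {B : OrderedBratteliDiagram} {μ : Measure B.Path} {q : ℕ → ℕ} (hq : B.IsToeplitz q)
  (hB : B.IsProperlyOrdered)

include hq

theorem IsToeplitz.rank_le {d : ℕ} {label : ∀ n, Fin d → B.V n} (hproper : B.IsProper label)
    {n : ℕ} (hn : 1 ≤ n) : d ≤ q (n + 1) := by
  obtain ⟨x, -⟩ := exists_tau_eq 0 (default : B.V 0)
  have hex : ∀ u : B.V n, ∃ e : {e : B.E n // B.tgt e = B.tau (n + 1) x}, B.src e.1 = u := by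
    intro u
    have := (Nat.card_pos_iff.1 (hproper.pos n hn u (B.tau (n + 1) x))).1
    obtain ⟨e, he, he'⟩ := this
    exact ⟨⟨e, he'⟩, he⟩
  choose e he using hex
  have hinj : Function.Injective e := fun u v h => by rw [← he u, ← he v, h]
  have := Nat.card_le_card_of_injective e hinj
  rwa [hq, ← Nat.card_congr (Equiv.ofBijective _ (hproper.rank n hn)), Nat.card_eq_fintype_card,
    Fintype.card_fin] at this

/-- Every factor after the first is at least `d ≥ 2`, as each vertex of the previous level sends an
edge to each vertex (`rank_le`). The first factor is only known to be positive, whence its separate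
case. -/
theorem IsToeplitz.tendsto_qProd {d : ℕ} {label : ∀ n, Fin d → B.V n}
    (hproper : B.IsProper label) (hd : 2 ≤ d) : Tendsto (fun n => qProd q 0 n) atTop atTop := by
  refine tendsto_atTop_mono (fun n => ?_) tendsto_id
  induction n with
  | zero => exact Nat.zero_le _
  | succ n ih =>
    rcases Nat.eq_zero_or_pos n with rfl | hn
    · exact hq.qProd_pos 0 1
    · have h1 := hq.rank_le hproper hn
      have h2 := hq.qProd_pos 0 n
      rw [qProd_succ q (Nat.zero_le n)]
      simp only [id] at ih ⊢
      nlinarith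

variable [IsProbabilityMeasure μ]

theorem IsToeplitz.isMeasurableEigenvalue_of_le_sum_suffix
    (hT : MeasurePreserving (B.vershik hB) μ μ)
    (hp : Tendsto (fun n => qProd q 0 n) atTop atTop) {lam : ℂ} (hlam : ‖lam‖ = 1) {ι : Type*}
    (I : Finset ι) {m : ℕ} (t₁ : ι → B.V m) (t₂ : ∀ n, B.V n) {c : ℝ} (hc : 0 < c)
    (h : ∀ n > m, c ≤ μ.real {x | B.tau n x = t₂ n} *
      ∑ i ∈ I, ‖∑ s ∈ B.suffixFinset m n (t₁ i) (t₂ n),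
        lam ^ (-((qProd q 0 m : ℤ) * (s : ℤ)))‖ / (qProd q m n : ℝ)) :
    IsMeasurableEigenvalue (B.vershik hB) μ lam := by
  have hl0 : lam ≠ 0 := norm_ne_zero_iff.1 (by rw [hlam]; exact one_ne_zero)
  let φ : ∀ n, B.V n → B.Path → ℂ := fun n t =>
    {x | B.tau n x = t}.indicator fun x => (lam ^ addr q 0 n x)⁻¹
  have hφ1 : ∀ n t x, ‖φ n t x‖ ≤ 1 := fun n t x =>
    (norm_indicator_le_norm_self _ _).trans (by simp [hlam])
  have hφm : ∀ n t, AEStronglyMeasurable (φ n t) μ := fun n t =>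
    (((measurable_of_countable fun k : ℕ => (lam ^ k)⁻¹).comp
      (measurable_addr q 0 n)).indicator (measurableSet_tau_eq n t)).aestronglyMeasurable
  have hφ : ∀ n t, MemLp (φ n t) 2 μ := fun n t =>
    MemLp.of_bound (hφm n t) 1 (ae_of_all _ (hφ1 n t))
  let U := (Lp.compMeasurePreservingₗᵢ (E := ℂ) (p := 2) ℂ (B.vershik hB) hT).toContinuousLinearMap
  let F : ℕ → Lp ℂ 2 μ := fun n => (hφ n (t₂ n)).toLp
  have hbound : ∀ n, ‖F n‖ ≤ 1 := by
    intro n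
    refine pow_le_one_iff_of_nonneg (norm_nonneg _) two_ne_zero |>.1 ?_
    rw [norm_toLp_two_sq]
    calc ∫ x, ‖φ n (t₂ n) x‖ ^ 2 ∂μ ≤ ∫ x, (1 : ℝ) ∂μ :=
          integral_mono (hφ n (t₂ n)).integrable_norm_pow' (integrable_const _)
            fun x => pow_le_one₀ (norm_nonneg _) (hφ1 n _ x)
      _ = 1 := by simp
  -- The defect vanishes off the top level, has modulus at most 2 there, and that level has measure
  -- `1 / qProd q 0 n`.
  have hUF : ∀ n, ‖U (F n) - lam • F n‖ ^ 2 ≤ 4 * (qProd q 0 n : ℝ)⁻¹ := by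
    intro n
    have hd : MemLp (φ n (t₂ n) ∘ B.vershik hB - lam • φ n (t₂ n)) 2 μ :=
      ((hφ n (t₂ n)).comp_measurePreserving hT).sub ((hφ n (t₂ n)).const_smul lam)
    have h1 : U (F n) - lam • F n = hd.toLp := by
      rfl
    have hS : MeasurableSet {x : B.Path | addr q 0 n x = 0} :=
      measurable_addr q 0 n (measurableSet_singleton 0)
    rw [h1, norm_toLp_two_sq, ← hq.measureReal_addr_eq hB hT n (hq.qProd_pos 0 n)]
    calc _ ≤ ∫ x, {x : B.Path | addr q 0 n x = 0}.indicator (fun _ => (4 : ℝ)) x ∂μ := by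
          refine integral_mono hd.integrable_norm_pow' ((integrable_const _).indicator hS)
            fun x => ?_
          by_cases hx : x ∈ {x : B.Path | addr q 0 n x = 0}
          · rw [Set.indicator_of_mem hx]
            have h2 : ‖φ n (t₂ n) (B.vershik hB x) - lam * φ n (t₂ n) x‖ ≤ 2 := by
              refine (norm_sub_le _ _).trans ?_
              rw [norm_mul, hlam, one_mul]
              linarith [hφ1 n (t₂ n) (B.vershik hB x), hφ1 n (t₂ n) x]
            calc _ ≤ (2 : ℝ) ^ 2 := pow_le_pow_left₀ (norm_nonneg _) h2 2
              _ = 4 := by norm_num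
          · rw [Set.indicator_of_notMem hx]
            obtain ⟨h2, h3⟩ := (hq.addr_vershik hB n x).resolve_right fun h => hx h.1
            have h4 : φ n (t₂ n) (B.vershik hB x) = lam * φ n (t₂ n) x := by
              have hiff : B.vershik hB x ∈ {x | B.tau n x = t₂ n} ↔
                  x ∈ {x | B.tau n x = t₂ n} := by
                rw [Set.mem_ofPred_eq, h3, Set.mem_ofPred_eq]
              simp only [φ]
              by_cases ht : x ∈ {x | B.tau n x = t₂ n}
              · rw [Set.indicator_of_mem (hiff.2 ht), Set.indicator_of_mem ht, h2, pow_succ]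
                field_simp
              · rw [Set.indicator_of_notMem (hiff.not.2 ht), Set.indicator_of_notMem ht, mul_zero]
            simp [h4]
      _ = _ := by
          rw [integral_indicator hS]
          simp [mul_comm]
  have hU0 : Tendsto (fun n => U (F n) - lam • F n) atTop (𝓝 0) := by
    rw [tendsto_zero_iff_norm_tendsto_zero]
    have h1 : Tendsto (fun n => 4 * (qProd q 0 n : ℝ)⁻¹) atTop (𝓝 0) := by
      simpa using ((tendsto_natCast_atTop_atTop.comp hp).inv_tendsto_atTop).const_mul (4 : ℝ)
    have h2 := squeeze_zero (fun n => sq_nonneg _) hUF h1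
    have h3 := (Real.continuous_sqrt.tendsto 0).comp h2
    simpa [Function.comp_def, Real.sqrt_sq] using h3
  -- The pairing of the level `n` and level `m` functions is the integral of `lam ^ (-p_m *
  -- addr_{m,n})` over the intersection of their towers.
  have hinner : ∀ n > m, ∀ i, ‖inner ℂ (F n) ((hφ m (t₁ i)).toLp)‖ =
      μ.real {x | B.tau n x = t₂ n} * (‖∑ s ∈ B.suffixFinset m n (t₁ i) (t₂ n),
        lam ^ (-((qProd q 0 m : ℤ) * (s : ℤ)))‖ / (qProd q m n : ℝ)) := by
    intro n hn i
    have h1 := hq.setIntegral_tau_tau_comp_addr hB hT hn (t₁ i) (t₂ n)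
      fun s => lam ^ (-((qProd q 0 m : ℤ) * (s : ℤ)))
    have h2 : inner ℂ ((hφ m (t₁ i)).toLp) (F n) =
        ∫ x in {x | B.tau m x = t₁ i} ∩ {x | B.tau n x = t₂ n},
          lam ^ (-((qProd q 0 m : ℤ) * (addr q m n x : ℤ))) ∂μ := by
      rw [L2.inner_def, ← integral_indicator
        ((measurableSet_tau_eq m (t₁ i)).inter (measurableSet_tau_eq n (t₂ n)))]
      refine integral_congr_ae ?_
      filter_upwards [(hφ m (t₁ i)).coeFn_toLp, (hφ n (t₂ n)).coeFn_toLp] with x hx hx'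
      simp only [F]
      rw [hx, hx', RCLike.inner_apply]
      simp only [φ]
      by_cases hx1 : x ∈ {x | B.tau m x = t₁ i}
      · by_cases hx2 : x ∈ {x | B.tau n x = t₂ n}
        · rw [Set.indicator_of_mem hx1, Set.indicator_of_mem hx2,
            Set.indicator_of_mem (Set.mem_inter hx1 hx2), ← Complex.inv_eq_conj (by simp [hlam]),
            inv_inv, addr_add q (Nat.zero_le m) hn.le x, zpow_neg, ← Nat.cast_mul, zpow_natCast,
            pow_add]
          field_simp
        · rw [Set.indicator_of_notMem hx2, Set.indicator_of_notMem
            (Set.notMem_subset Set.inter_subset_right hx2), zero_mul]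
      · rw [Set.indicator_of_notMem hx1, Set.indicator_of_notMem
          (Set.notMem_subset Set.inter_subset_left hx1), map_zero, mul_zero]
    rw [norm_inner_symm, h2, h1, norm_mul, Complex.norm_real, Real.norm_of_nonneg (by positivity)]
    ring
  obtain ⟨v, hv0, hv⟩ := exists_eigenvector_of_tendsto U lam hbound hU0 I
    (fun i => (hφ m (t₁ i)).toLp) hc (by
      filter_upwards [eventually_gt_atTop m] with n hn
      rw [Finset.sum_congr rfl fun i _ => hinner n hn i, ← Finset.mul_sum]
      exact h n hn)
  refine ⟨v, Lp.memLp v, fun h0 => hv0 ((Lp.eq_zero_iff_ae_eq_zero).2 h0), ?_⟩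
  have h1 := Lp.coeFn_compMeasurePreserving v hT
  have h2 := Lp.coeFn_smul lam v
  have h3 : Lp.compMeasurePreserving (B.vershik hB) hT v = lam • v := hv
  rw [h3] at h1
  filter_upwards [h1, h2] with x h1 h2
  rw [h2] at h1
  exact h1.symm

end OrderedBratteliDiagram

/-! ### The equivalence. -/

theorem IsPrimitiveRoot.orderOf_pow_eq_div_gcd {lam : ℂ} {b : ℕ} (h : IsPrimitiveRoot lam b)
    {p : ℕ} (hp : 0 < p) : orderOf (lam ^ p) = b / Nat.gcd b p := by
  rw [orderOf_pow' lam hp.ne', h.eq_orderOf]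

theorem mainTheorem3
    (B : OrderedBratteliDiagram) (hB : B.IsProperlyOrdered)
    (d : ℕ) (label : ∀ n, Fin d → B.V n) (hproper : B.IsProper label)
    (q : ℕ → ℕ) (hq : B.IsToeplitz q)
    (Iset : MeasureTheory.Measure B.Path → Finset (Fin d)) (hclean : B.IsClean hB label Iset)
    (μ : MeasureTheory.Measure B.Path) (hprob : MeasureTheory.IsProbabilityMeasure μ)
    (hμ : Ergodic (B.vershik hB) μ)
    (a : ℤ) (b : ℕ) (hb : 0 < b) (hab : IsCoprime a (b : ℤ))
    (lam : ℂ) (hlam : lam = Complex.exp (2 * Complex.I * Real.pi * ((a : ℂ) / (b : ℂ)))) :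
    IsNonContinuousEigenvalue (B.vershik hB) μ lam ↔
      (∃ b' : ℕ, 1 < b' ∧ b' ≤ d ∧
        ∀ᶠ n in Filter.atTop, b / Nat.gcd b (pProd q n) = b') ∧
      (∀ t₂ ∈ Iset μ, ∀ ε : ℝ, 0 < ε → ∃ N : ℕ, ∀ m n : ℕ, N ≤ m → m < n →
        |(∑ t₁ ∈ Iset μ,
            ‖∑ s ∈ B.suffixFinset m n (label m t₁) (label n t₂),
                lam ^ (-((pProd q m : ℤ) * (s : ℤ)))‖ / (qProd q m n : ℝ)) - 1| < ε) := by
  obtain ⟨δ, hδ, hI, -⟩ := hclean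
  obtain ⟨hI, hI'⟩ := hI μ hprob hμ
  have hT := hμ.toMeasurePreserving
  have hprim : IsPrimitiveRoot lam b := by
    rw [hlam, mul_right_comm]
    convert Complex.isPrimitiveRoot_exp_of_isCoprime a b hb.ne' hab using 2
    ring
  have hlamb : lam ^ b = 1 := hprim.pow_eq_one
  have hl1 : ‖lam‖ = 1 := Complex.norm_eq_one_of_pow_eq_one hlamb hb.ne'
  have hord : ∀ n, orderOf (lam ^ qProd q 0 n) = b / Nat.gcd b (pProd q n) := fun n =>
    hprim.orderOf_pow_eq_div_gcd (hq.qProd_pos 0 n)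
  have hcont := hq.isContinuousEigenvalue_iff hB hproper hb hlamb
  constructor
  · rintro ⟨hmeas, hnc⟩
    obtain ⟨f, hf, hfb, hfT⟩ := exists_eigenfunction_pow_eq_one hμ hb hlamb hmeas
    refine ⟨?_, fun t₂ ht₂ ε hε => hq.abs_sum_suffix_sub_one_lt hB hT hproper (Iset μ) hδ hI hI'
      hl1 hf (fun x => Complex.norm_eq_one_of_pow_eq_one (hfb x) hb.ne') hfT ht₂ hε⟩
    -- The numbers `gcd(b, p_n)` increase along divisibility and are bounded by `b`, so they
    -- stabilise.
    obtain ⟨n₀, hn₀⟩ := Nat.exists_eventually_eq_of_monotone_of_le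
      (g := fun n => Nat.gcd b (pProd q n))
      (monotone_nat_of_le_succ fun n => Nat.le_of_dvd (Nat.gcd_pos_of_pos_left _ hb)
        (Nat.gcd_dvd_gcd_of_dvd_right b
          ⟨q (n + 1), qProd_succ q (Nat.zero_le n)⟩))
      fun n => Nat.gcd_le_left _ hb
    obtain ⟨N, hN⟩ := hq.exists_orderOf_le_card hB hT hb hlamb hf hfb hfT
    refine ⟨b / Nat.gcd b (pProd q n₀), ?_, ?_, ?_⟩
    · rw [← hord]
      have h1 : orderOf (lam ^ qProd q 0 n₀) ≠ 1 := fun h =>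
        hnc (hcont.2 ⟨n₀, orderOf_eq_one_iff.1 h⟩)
      have h2 : 0 < orderOf (lam ^ qProd q 0 n₀) := orderOf_pos_iff.2
        (isOfFinOrder_iff_pow_eq_one.2 ⟨b, hb, by
          rw [← pow_mul, mul_comm, pow_mul, hlamb, one_pow]⟩)
      omega
    · let k := max (max n₀ N) 1
      have h1 := hN k ((le_max_right _ _).trans (le_max_left _ _))
      rw [hord, hn₀ k ((le_max_left _ _).trans (le_max_left _ _)),
        ← Nat.card_congr (Equiv.ofBijective _ (hproper.rank k (le_max_right _ _))),
        Nat.card_eq_fintype_card, Fintype.card_fin] at h1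
      exact h1
    · filter_upwards [eventually_ge_atTop n₀] with n hn
      rw [hn₀ n hn]
  · rintro ⟨⟨b', hb', hb'd, hev⟩, hsum⟩
    refine ⟨?_, fun h => ?_⟩
    -- The masses of the `d` towers of a level add up to 1, so they cannot all tend to zero.
    · obtain ⟨t₂, ht₂⟩ : (Iset μ).Nonempty := by
        by_contra hne
        rw [Finset.not_nonempty_iff_eq_empty] at hne
        have h1 : Tendsto (fun n => ∑ t, μ.real {x | B.tau n x = label n t}) atTop
            (𝓝 (∑ t : Fin d, 0)) :=
          tendsto_finsetSum _ fun t _ => hI' t (by simp [hne])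
        have h2 : ∀ᶠ n in atTop, ∑ t, μ.real {x | B.tau n x = label n t} = 1 := by
          filter_upwards [eventually_ge_atTop 1] with n hn
          have := OrderedBratteliDiagram.integral_eq_sum_label hproper hn
            (integrable_const (μ := μ) (1 : ℝ))
          simpa using this.symm
        have h3 := tendsto_nhds_unique h1 (tendsto_const_nhds.congr' (h2.mono fun _ h => h.symm))
        simp at h3
      -- A single `t₂`, the fixed level `m = N` and the bound `1/2` are enough: the pairings then
      -- sum to at least `δ / 2` for all `n > N`. The inequality `1 < b' ≤ d` enters through `p_n →
      -- ∞`.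
      obtain ⟨N, hN⟩ := hsum t₂ ht₂ (1 / 2) (by norm_num)
      refine hq.isMeasurableEigenvalue_of_le_sum_suffix hB hT
        (hq.tendsto_qProd hproper (by omega)) hl1 (Iset μ) (m := N) (label N)
        (fun n => label n t₂) (half_pos hδ) fun n hn => ?_
      have h1 := hI t₂ ht₂ n (by omega)
      have h2 := (abs_lt.1 (hN N n le_rfl hn)).1
      rw [div_eq_mul_one_div δ 2]
      exact mul_le_mul h1 (by linarith!) (by norm_num) (hδ.le.trans h1)
    -- Once `lam ^ p_n = 1`, the same holds at all later levels, so the order would be 1 instead of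
    -- `b'`.
    · obtain ⟨n, hn⟩ := hcont.1 h
      obtain ⟨k, hk, hkn⟩ := (hev.and (eventually_ge_atTop n)).exists
      have h1 : lam ^ qProd q 0 k = 1 := by
        rw [← qProd_mul_qProd q (Nat.zero_le n) hkn, pow_mul, hn, one_pow]
      rw [← hord, h1, orderOf_one] at hk
      omega
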